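/- Let $n\ge 1$ and let $M^n$ be a complete connected smooth Riemannian manifold, possibly with smooth boundary $\partial M$. Consider the Riemannian product $M\times\mathbb{R}$ with vertical unit field $\xi=(0,1)$ and slices $M_s=M\times\{s\}$, and the product weight $e^{\psi}$, $\psi(p,t)=h(p)+v(t)$, with $h\in C^\infty(M)$ and $v\in C^\infty(\mathbb{R})$. Suppose that there are $\lambda\ge 0$ and $a\in\mathbb{R}$ with $v'(t)\ge\lambda$ for all $t\le a$. Let $\Sigma$ be a connected two-sided smooth (immersed) hypersurface of $M\times\mathbb{R}$, possibly with smooth boundary $\partial\Sigma$, with the induced metric and a smooth unit normal $N$. Its $\psi$-mean curvature with respect to $N$ is $H_\psi=-\operatorname{div}_\Sigma N-\langle\nabla\psi,N\rangle$. Assume that $\Sigma\subseteq M\times(-\infty,a]$ and that $\Sigma$ is $\psi$-parabolic: every $u\in C^2(\Sigma)$ that is bounded from above, satisfies $\Delta_\Sigma u+\langle\nabla_\Sigma\psi,\nabla_\Sigma u\rangle\ge 0$ on $\Sigma\setminus\partial\Sigma$ and $\partial u/\partial\nu\ge 0$ along $\partial\Sigma$ ($\nu$ the inner unit conormal) is constant.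 Assume finally that either $|H_\psi|\le\lambda$ on $\Sigma$, or $\Sigma$ is a horizontal multigraph, i.e. $\langle\xi,N\rangle\le 0$ on $\Sigma$, with $H_\psi\le\lambda$ on $\Sigma$. (i) If $\partial\Sigma\ne\emptyset$ and $\Sigma$ is tangent to $M_a$ along $\partial\Sigma$ (that is, $\partial\Sigma\subseteq M_a$ and $T_x\Sigma=T_xM_a$ for all $x\in\partial\Sigma$), then $\Sigma\subseteq M_a$ and the $\psi$-mean curvature of $M_a$ with respect to $-\xi$ is identically $\lambda$. (ii) If $\Sigma$ is complete and has free boundary in $\partial M\times\mathbb{R}$ (that is, $\partial\Sigma=\Sigma\cap(\partial M\times\mathbb{R})$, possibly empty, and $\Sigma$ is orthogonal to $\partial M\times\mathbb{R}$ along $\partial\Sigma$), then $\Sigma=M_s$ for some $s\in\mathbb{R}$ such that the $\psi$-mean curvature of $M_s$ with respect to $-\xi$ is identically $\lambda$. -/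

import Mathlib

open Set Bundle Manifold
open scoped ContDiff

noncomputable section

namespace WeightedCylinder

section Coordinates

variable {E : Type*} [NormedAddCommGroup E] [NormedSpace ℝ E]
  {H : Type*} [TopologicalSpace H] {I : ModelWithCorners ℝ E H}
  {P : Type*} [TopologicalSpace P] [ChartedSpace H P]

/-- The coefficient `g(v, w)` of a metric tensor `g`, read at the point `y` of the model space in
the preferred chart around `x`; the vectors `v`, `w` are constant in this chart. -/
def coordMetric (g : ∀ x : P, TangentSpace I x → TangentSpace I x → ℝ) (x : P) (v w y : E) : ℝ :=
  g ((extChartAt I x).symm y)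
    (mfderivWithin 𝓘(ℝ, E) I (extChartAt I x).symm (range I) y v)
    (mfderivWithin 𝓘(ℝ, E) I (extChartAt I x).symm (range I) y w)

/-- The derivative at `x`, in the direction `u`, of the coefficient `g(v, w)` of the metric in the
preferred chart around `x`. -/
def dMetric (g : ∀ x : P, TangentSpace I x → TangentSpace I x → ℝ) (x : P) (u v w : E) : ℝ :=
  fderivWithin ℝ (coordMetric g x v w) (range I) (extChartAt I x x) u

/-- The Christoffel symbol of the first kind `g(D_u v, w)` at `x`, where `D` is the Levi-Civita
connection of `g` and `u`, `v`, `w` are extended as constant fields in the preferred chart around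
`x`. -/
def christoffel (g : ∀ x : P, TangentSpace I x → TangentSpace I x → ℝ) (x : P) (u v w : E) : ℝ :=
  (dMetric g x u v w + dMetric g x v u w - dMetric g x w u v) / 2

end Coordinates

section Riemannian

variable {E : Type*} [NormedAddCommGroup E] [NormedSpace ℝ E] [FiniteDimensional ℝ E]
  {H : Type*} [TopologicalSpace H] (I : ModelWithCorners ℝ E H)
  {S : Type*} [TopologicalSpace S] [ChartedSpace H S]
  [RiemannianBundle (fun x : S => TangentSpace I x)]

/-- The metric tensor of a Riemannian manifold. -/
def metricTensor (x : S) (v w : TangentSpace I x) : ℝ := inner ℝ v w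

instance finiteDimensional_tangentSpace (x : S) : FiniteDimensional ℝ (TangentSpace I x) :=
  inferInstanceAs (FiniteDimensional ℝ E)

/-- The trace of a bilinear form on `T_x S`, with respect to the Riemannian metric. -/
def metricTrace (x : S) (B : TangentSpace I x → TangentSpace I x → ℝ) : ℝ :=
  ∑ i, B (stdOrthonormalBasis ℝ (TangentSpace I x) i) (stdOrthonormalBasis ℝ (TangentSpace I x) i)

/-- The differential of a function at `x`, as a function on `T_x S`. -/
def differential {S : Type*} [TopologicalSpace S] [ChartedSpace H S] (u : S → ℝ) (x : S)
    (v : TangentSpace I x) : ℝ :=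
  mfderiv I 𝓘(ℝ, ℝ) u x v

/-- The Riemannian gradient, written in an orthonormal basis. -/
def grad (u : S → ℝ) (x : S) : TangentSpace I x :=
  ∑ i, differential I u x (stdOrthonormalBasis ℝ (TangentSpace I x) i) •
    stdOrthonormalBasis ℝ (TangentSpace I x) i

/-- The Hessian of `u` with respect to the Levi-Civita connection, computed in the preferred chart
at `x`: the second derivative of `u` at `(v, w)`, minus `du (D_v w) = g(D_v w, ∇u)`. -/
def hessian (u : S → ℝ) (x : S) (v w : TangentSpace I x) : ℝ :=
  (fderivWithin ℝ (fderivWithin ℝ (u ∘ (extChartAt I x).symm) (range I)) (range I)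
      (extChartAt I x x) : E →L[ℝ] E →L[ℝ] ℝ) v w
    - christoffel (metricTensor I) x v w (grad I u x)

/-- The drifted Laplacian `Δ u + ⟨∇ψ, ∇u⟩` of a Riemannian manifold with weight `e^ψ`. -/
def driftedLaplacian (ψ u : S → ℝ) (x : S) : ℝ :=
  metricTrace I x (hessian I u x) + inner ℝ (grad I ψ x) (grad I u x)

end Riemannian

section Boundary

variable {n : ℕ} [NeZero n]
  {S : Type*} [TopologicalSpace S] [ChartedSpace (EuclideanHalfSpace n) S]

/-- The component of a tangent vector transverse to the boundary of the half-space, in the preferred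
chart at `x`. If `x` is a boundary point, then it vanishes exactly on the vectors tangent to the
boundary, and is positive exactly on the vectors that point strictly inwards. -/
def transverse (x : S) (w : TangentSpace (𝓡∂ n) x) : ℝ :=
  (show EuclideanSpace ℝ (Fin n) from w) 0

variable [RiemannianBundle (fun x : S => TangentSpace (𝓡∂ n) x)]

/-- `ν` is the inner unit normal to the boundary at `x` (to be used at boundary points). -/
def IsInnerUnitNormal (x : S) (ν : TangentSpace (𝓡∂ n) x) : Prop :=
  inner ℝ ν ν = 1 ∧ (∀ w : TangentSpace (𝓡∂ n) x, transverse x w = 0 → inner ℝ ν w = 0) ∧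
    0 < transverse x ν

/-- Weighted parabolicity of a Riemannian manifold with boundary, with weight `e^ψ`: a `C²` function
that is bounded from above, `ψ`-subharmonic in the interior and satisfies the Neumann condition
`∂u/∂ν ≥ 0` along the boundary, is constant. -/
def IsParabolic (ψ : S → ℝ) : Prop :=
  ∀ u : S → ℝ, ContMDiff (𝓡∂ n) 𝓘(ℝ, ℝ) 2 u → BddAbove (range u) →
    (∀ x ∈ (𝓡∂ n).interior S, 0 ≤ driftedLaplacian (𝓡∂ n) ψ u x) →
    (∀ x ∈ (𝓡∂ n).boundary S, ∀ ν : TangentSpace (𝓡∂ n) x, IsInnerUnitNormal x ν →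
      0 ≤ differential (𝓡∂ n) u x ν) →
    ∃ c : ℝ, ∀ x, u x = c

end Boundary

section Cylinder

variable {n : ℕ} [NeZero n]

/-- The model with corners of the cylinder `M × ℝ`. -/
abbrev cylModel (n : ℕ) [NeZero n] :
    ModelWithCorners ℝ (EuclideanSpace ℝ (Fin n) × ℝ) (ModelProd (EuclideanHalfSpace n) ℝ) :=
  (𝓡∂ n).prod 𝓘(ℝ, ℝ)

variable {M : Type*} [TopologicalSpace M] [ChartedSpace (EuclideanHalfSpace n) M]

/-- The component in `T_p M` of a vector tangent to `M × ℝ` at `y = (p, t)`. -/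
def horiz (y : M × ℝ) (w : TangentSpace (cylModel n) y) : TangentSpace (𝓡∂ n) y.1 :=
  (show EuclideanSpace ℝ (Fin n) × ℝ from w).1

/-- The component in `ℝ` of a vector tangent to `M × ℝ` at `y = (p, t)`. -/
def vert (y : M × ℝ) (w : TangentSpace (cylModel n) y) : ℝ :=
  (show EuclideanSpace ℝ (Fin n) × ℝ from w).2

/-- The vertical vector field `ξ = (0, 1)`. -/
def xi (y : M × ℝ) : TangentSpace (cylModel n) y :=
  (show TangentSpace (cylModel n) y from ((0, 1) : EuclideanSpace ℝ (Fin n) × ℝ))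

/-- The inclusion of the horizontal slice `M × {s}`. -/
def slice (s : ℝ) (p : M) : M × ℝ := (p, s)

/-- The downward unit normal `-ξ` along the horizontal slice `M × {s}`. -/
def sliceNormal (s : ℝ) (p : M) : TangentSpace (cylModel n) (slice s p) := -xi (slice s p)

/-- The product weight exponent `ψ(p, t) = h(p) + v(t)`. -/
def productWeight (h : M → ℝ) (v : ℝ → ℝ) (y : M × ℝ) : ℝ := h y.1 + v y.2

variable [RiemannianBundle (fun x : M => TangentSpace (𝓡∂ n) x)]

/-- The product metric of `M × ℝ`. -/
def cylMetric (y : M × ℝ) (v w : TangentSpace (cylModel n) y) : ℝ :=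
  inner ℝ (horiz y v) (horiz y w) + vert y v * vert y w

variable {S : Type*} [TopologicalSpace S] [ChartedSpace (EuclideanHalfSpace n) S]
  [RiemannianBundle (fun x : S => TangentSpace (𝓡∂ n) x)]

/-- `F : S → M × ℝ` is an immersed hypersurface, the metric of `S` is the induced one, and `N` is a
Gauss map, i.e. a smooth unit normal field along `F`. (A two-sided embedded hypersurface is the case
where `F` is an inclusion.) -/
structure IsTwoSidedHypersurface [IsManifold (𝓡∂ n) ∞ M] (F : S → M × ℝ)
    (N : ∀ x : S, TangentSpace (cylModel n) (F x)) : Prop where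
  smooth : ContMDiff (𝓡∂ n) (cylModel n) ∞ F
  isometric : ∀ (x : S) (v w : TangentSpace (𝓡∂ n) x),
    cylMetric (F x) (mfderiv (𝓡∂ n) (cylModel n) F x v) (mfderiv (𝓡∂ n) (cylModel n) F x w)
      = inner ℝ v w
  smooth_normal : ContMDiff (𝓡∂ n) (cylModel n).tangent ∞
    (fun x => (⟨F x, N x⟩ : TangentBundle (cylModel n) (M × ℝ)))
  unit : ∀ x, cylMetric (F x) (N x) (N x) = 1
  normal : ∀ (x : S) (v : TangentSpace (𝓡∂ n) x),
    cylMetric (F x) (N x) (mfderiv (𝓡∂ n) (cylModel n) F x v) = 0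

/-- The components of a vector field `X` along `F` in the preferred chart of `M × ℝ` around `F x`,
as a function of the point `z`. -/
def coordField {S : Type*} (F : S → M × ℝ) (X : ∀ x : S, TangentSpace (cylModel n) (F x))
    (x z : S) : EuclideanSpace ℝ (Fin n) × ℝ :=
  mfderiv (cylModel n) 𝓘(ℝ, EuclideanSpace ℝ (Fin n) × ℝ) (extChartAt (cylModel n) (F x)) (F z)
    (X z)

/-- `⟨D_v X, w⟩` at `x`, for a vector field `X` along `F`, where `D` is the Levi-Civita connection
of `M × ℝ`. -/
def covDerivInner (F : S → M × ℝ) (X : ∀ x : S, TangentSpace (cylModel n) (F x)) (x : S)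
    (v : TangentSpace (𝓡∂ n) x) (w : TangentSpace (cylModel n) (F x)) : ℝ :=
  cylMetric (F x)
      (mfderiv (𝓡∂ n) 𝓘(ℝ, EuclideanSpace ℝ (Fin n) × ℝ) (coordField F X x) x v) w
    + christoffel cylMetric (F x) (mfderiv (𝓡∂ n) (cylModel n) F x v) (X x) w

/-- The weighted divergence `div_Σ X + ⟨∇ψ, X⟩` of a vector field `X` along the hypersurface. -/
def weightedDiv (ψ : M × ℝ → ℝ) (F : S → M × ℝ) (X : ∀ x : S, TangentSpace (cylModel n) (F x))
    (x : S) : ℝ :=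
  metricTrace (𝓡∂ n) x
      (fun v w => covDerivInner F X x v (mfderiv (𝓡∂ n) (cylModel n) F x w))
    + differential (cylModel n) ψ (F x) (X x)

/-- The weighted mean curvature `H_ψ` with respect to the Gauss map `N`. -/
def weightedMeanCurvature (ψ : M × ℝ → ℝ) (F : S → M × ℝ)
    (N : ∀ x : S, TangentSpace (cylModel n) (F x)) (x : S) : ℝ :=
  -weightedDiv ψ F N x

/-- The angle function `θ = ⟨ξ, N⟩`. -/
def angle (F : S → M × ℝ) (N : ∀ x : S, TangentSpace (cylModel n) (F x)) (x : S) : ℝ :=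
  cylMetric (F x) (xi (F x)) (N x)

/-- The hypersurface is tangent to the slice `M × {a}` along its boundary: boundary points lie in
the slice, and there the tangent space is the horizontal one. -/
def IsTangentToSlice {S : Type*} [TopologicalSpace S] [ChartedSpace (EuclideanHalfSpace n) S]
    {M : Type*} [TopologicalSpace M] [ChartedSpace (EuclideanHalfSpace n) M]
    (F : S → M × ℝ) (a : ℝ) : Prop :=
  ∀ x ∈ (𝓡∂ n).boundary S, (F x).2 = a ∧
    ∀ w : TangentSpace (cylModel n) (F x),
      (∃ v : TangentSpace (𝓡∂ n) x, mfderiv (𝓡∂ n) (cylModel n) F x v = w) ↔ vert (F x) w = 0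

/-- Free boundary in `∂M × ℝ`: the boundary of the hypersurface is its intersection with `∂M × ℝ`,
and there it is orthogonal to `∂M × ℝ`, i.e. the Gauss map is tangent to `∂M × ℝ`. -/
def HasFreeBoundary {S : Type*} [TopologicalSpace S] [ChartedSpace (EuclideanHalfSpace n) S]
    {M : Type*} [TopologicalSpace M] [ChartedSpace (EuclideanHalfSpace n) M]
    (F : S → M × ℝ) (N : ∀ x : S, TangentSpace (cylModel n) (F x)) : Prop :=
  (∀ x, x ∈ (𝓡∂ n).boundary S ↔ (F x).1 ∈ (𝓡∂ n).boundary M) ∧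
    ∀ x ∈ (𝓡∂ n).boundary S, transverse (F x).1 (horiz (F x) (N x)) = 0

end Cylinder

end WeightedCylinder

end

/-!
The height function `η` of the hypersurface satisfies `Δ_ψ η = v'(η) + θ H_ψ` with `θ = ⟨ξ, N⟩`, and
`|θ| ≤ 1`, so both curvature hypotheses make `η` a `ψ`-subharmonic function. It is bounded above by
`a`, and its conormal derivative vanishes under either boundary condition, so parabolicity makes it
constant, say `η = s`. The inequality `v'(s) + θ H_ψ ≥ λ - λ` is then an equality, which forces
`v'(s) = λ`, and `v'(s)` is the `ψ`-mean curvature of the slice `M_s`.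

If the boundary is free, then the projection `f : S → M` is moreover an isometric immersion between
manifolds of the same dimension, with `f⁻¹(∂M) = ∂S`, so it is locally invertible, also at boundary
points. Hence short curves in `M` lift, and Ekeland's variational principle on the complete space
`S`, applied to the distance from `f` to a point `q`, shows that `f` attains the value `q`.
-/

namespace WeightedCylinder

open Filter Topology Metric

section LocalInverse

variable {E : Type*} [NormedAddCommGroup E] [NormedSpace ℝ E]
  {F : Type*} [NormedAddCommGroup F] [NormedSpace ℝ F]

theorem exists_homeomorph_eventuallyEq [FiniteDimensional ℝ E] [FiniteDimensional ℝ F] {R : Set E}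
    (hR : Convex ℝ R) {f : E → F} {D : E → E →L[ℝ] F} {x₀ : E}
    (hf : ∀ᶠ z in 𝓝[R] x₀, HasFDerivWithinAt f (D z) R z) (hD : ContinuousWithinAt D R x₀)
    (hinv : (D x₀).IsInvertible) :
    ∃ G : E ≃ₜ F, f =ᶠ[𝓝[R] x₀] G := by
  have : CompleteSpace E := FiniteDimensional.complete ℝ E
  obtain ⟨A, hA⟩ := hinv
  obtain ⟨c, hc₀, hc⟩ : ∃ c : NNReal, 0 < c ∧
      (Subsingleton E ∨ lipschitzExtensionConstant F * c < ‖(A.symm : F →L[ℝ] E)‖₊⁻¹) := by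
    rcases subsingleton_or_nontrivial E with h | h
    · exact ⟨1, one_pos, Or.inl h⟩
    · have hpos := lipschitzExtensionConstant_pos F
      obtain ⟨c, hc₀, hc⟩ := exists_between (div_pos (inv_pos.2 A.nnnorm_symm_pos) hpos)
      exact ⟨c, hc₀, Or.inr (by rwa [lt_div_iff₀' hpos] at hc)⟩
  have hnear : ∀ᶠ z in 𝓝[R] x₀, ‖D z - A‖ ≤ c := by
    rw [ContinuousWithinAt, ← hA] at hD
    simpa only [mem_closedBall, dist_eq_norm] using
      hD.eventually_mem (closedBall_mem_nhds _ (NNReal.coe_pos.2 hc₀))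
  obtain ⟨r, hr, hball⟩ := Metric.mem_nhdsWithin_iff.1 (hf.and hnear)
  rw [inter_comm] at hball
  have happ : ApproximatesLinearOn f (A : E →L[ℝ] F) (R ∩ ball x₀ r) c := fun x hx y hy =>
    (hR.inter (convex_ball x₀ r)).norm_image_sub_le_of_norm_hasFDerivWithin_le'
      (fun z hz => (hball hz).1.mono inter_subset_left) (fun z hz => (hball hz).2) hy hx
  obtain ⟨G, hG⟩ := happ.exists_homeomorph_extension hc
  exact ⟨G, eventuallyEq_of_mem (inter_mem_nhdsWithin R (ball_mem_nhds x₀ hr)) hG⟩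

/- Near `G x₀` the set `G⁻¹(interior R')` is connected, meets the interior of `R`, and avoids the
frontier of `R`. -/
theorem tendsto_homeomorph_symm_nhdsWithin {X : Type*} [TopologicalSpace X] {R : Set X}
    (hR : IsClosed R) (hRi : R ⊆ closure (interior R)) {R' : Set F} (hR' : Convex ℝ R')
    (hRi' : (interior R').Nonempty) (G : X ≃ₜ F) {x₀ : X} (hx₀ : x₀ ∈ R)
    (hG : ∀ᶠ z in 𝓝[R] x₀, G z ∈ R' ∧ (G z ∈ frontier R' ↔ z ∈ frontier R)) :
    Tendsto G.symm (𝓝[R'] (G x₀)) (𝓝[R] x₀) := by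
  obtain ⟨W, hWo, hxW, hW⟩ := mem_nhdsWithin.1 hG
  obtain ⟨ρ, hρ, hball⟩ : ∃ ρ > 0, ball (G x₀) ρ ⊆ G.symm ⁻¹' W :=
    Metric.isOpen_iff.1 (hWo.preimage G.symm.continuous) _ (by simpa)
  set C := G.symm '' (interior R' ∩ ball (G x₀) ρ)
  have hCpre : IsPreconnected C :=
    (hR'.interior.inter (convex_ball _ _)).isPreconnected.image _ G.symm.continuous.continuousOn
  have hCmeets : (C ∩ interior R).Nonempty := by
    obtain ⟨z, ⟨hzW, hzρ⟩, hz⟩ := mem_closure_iff.1 (hRi hx₀) (W ∩ G ⁻¹' ball (G x₀) ρ)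
      (hWo.inter (isOpen_ball.preimage G.continuous)) ⟨hxW, mem_ball_self hρ⟩
    obtain ⟨hGz, hfr⟩ := hW ⟨hzW, interior_subset hz⟩
    refine ⟨z, ⟨G z, ⟨?_, hzρ⟩, G.symm_apply_apply z⟩, hz⟩
    by_contra hGz'
    exact (hfr.1 ⟨subset_closure hGz, hGz'⟩).2 hz
  have hCfrontier : ∀ z ∈ C, z ∉ frontier R := by
    rintro _ ⟨y, hy, rfl⟩ hfr
    have := (hW ⟨hball hy.2, hR.frontier_subset hfr⟩).2.2 hfr
    rw [G.apply_symm_apply] at this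
    exact this.2 hy.1
  have hCR : C ⊆ interior R := by
    refine hCpre.subset_left_of_subset_union isOpen_interior hR.isOpen_compl
      (disjoint_compl_right.mono_left interior_subset) (fun z hz => ?_) hCmeets
    by_contra! hz'
    rw [mem_union, not_or, notMem_compl_iff] at hz'
    exact hCfrontier z hz ⟨subset_closure hz'.2, hz'.1⟩
  refine tendsto_nhdsWithin_iff.2 ⟨?_, ?_⟩
  · simpa only [ContinuousWithinAt, G.symm_apply_apply] using
      G.symm.continuous.continuousWithinAt (s := R') (x := G x₀)
  filter_upwards [inter_mem_nhdsWithin R' (ball_mem_nhds (G x₀) hρ)] with y hy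
  have hy' : y ∈ closure (interior R' ∩ ball (G x₀) ρ) := by
    rw [inter_comm]
    refine isOpen_ball.inter_closure ⟨hy.2, ?_⟩
    rw [hR'.closure_interior_eq_closure_of_nonempty_interior hRi']
    exact subset_closure hy.1
  exact hR.closure_subset_iff.2 (hCR.trans interior_subset)
    (image_closure_subset_closure_image G.symm.continuous (mem_image_of_mem _ hy'))

theorem contDiffOn_one_of_rightInvOn [CompleteSpace E] {s : Set E} {t : Set F}
    (hs : UniqueDiffOn ℝ s) (ht : UniqueDiffOn ℝ t) {f : E → F} {g : F → E}
    (hf : ContDiffOn ℝ 1 f s) (hg : ContinuousOn g t) (hgs : MapsTo g t s) (hfg : RightInvOn g f t)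
    (hinv : ∀ y ∈ t, (fderivWithin ℝ f s (g y)).IsInvertible) : ContDiffOn ℝ 1 g t := by
  rw [show (1 : WithTop ℕ∞) = 0 + 1 by norm_num,
    contDiffOn_succ_iff_hasFDerivWithinAt_of_uniqueDiffOn ht]
  refine ⟨by simp, fun y => (fderivWithin ℝ f s (g y)).inverse, ?_, fun y hy => ?_⟩
  · refine contDiffOn_zero.2 fun y hy => ?_
    have hinverse := (hinv y hy).contDiffAt_map_inverse (n := 0)
    exact hinverse.continuousAt.comp_continuousWithinAt (f := fun y => fderivWithin ℝ f s (g y))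
      ((hf.continuousOn_fderivWithin hs le_rfl _ (hgs hy)).comp (hg y hy) hgs)
  · have hderiv := (hf.differentiableOn one_ne_zero _ (hgs hy)).hasFDerivWithinAt
    obtain ⟨B, hB⟩ := hinv y hy
    beta_reduce
    rw [← hB] at hderiv ⊢
    rw [ContinuousLinearMap.inverse_equiv]
    exact hderiv.of_local_left_inverse
      (tendsto_nhdsWithin_iff.2 ⟨hg y hy, eventually_nhdsWithin_of_forall hgs⟩) hy
      (eventually_nhdsWithin_of_forall hfg)

theorem exists_contDiffOn_localInverse [FiniteDimensional ℝ E] [FiniteDimensional ℝ F]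
    {R U : Set E} {R' : Set F} (hR : IsClosed R) (hRc : Convex ℝ R) (hRi : (interior R).Nonempty)
    (hRc' : Convex ℝ R') (hRi' : (interior R').Nonempty) {f : E → F} {x₀ : E} (hU : IsOpen U)
    (hx₀ : x₀ ∈ R ∩ U) (hf : ContDiffOn ℝ 1 f (R ∩ U)) (hinv : (fderivWithin ℝ f R x₀).IsInvertible)
    (hmaps : MapsTo f (R ∩ U) R') (hfr : ∀ z ∈ R ∩ U, f z ∈ frontier R' ↔ z ∈ frontier R) :
    ∃ (g : F → E) (V : Set F), IsOpen V ∧ f x₀ ∈ V ∧ g (f x₀) = x₀ ∧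
      MapsTo g (R' ∩ V) (R ∩ U) ∧ RightInvOn g f (R' ∩ V) ∧ ContDiffOn ℝ 1 g (R' ∩ V) := by
  have : CompleteSpace E := FiniteDimensional.complete ℝ E
  have hs : UniqueDiffOn ℝ (R ∩ U) := (uniqueDiffOn_convex hRc hRi).inter hU
  have hUx : U ∈ 𝓝 x₀ := hU.mem_nhds hx₀.2
  have hRU : R ∩ U ∈ 𝓝[R] x₀ := inter_mem_nhdsWithin R hUx
  set D := fderivWithin ℝ f (R ∩ U) with hD
  rw [← fderivWithin_inter hUx] at hinv
  have hDc : ContinuousWithinAt D (R ∩ U) x₀ := hf.continuousOn_fderivWithin hs le_rfl x₀ hx₀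
  have hinv_near : ∀ᶠ z in 𝓝[R] x₀, (D z).IsInvertible := by
    rw [← nhdsWithin_inter_of_mem' (mem_nhdsWithin_of_mem_nhds hUx)]
    obtain ⟨A, hA⟩ := hinv
    exact hDc.eventually_mem (hA ▸ A.nhds)
  obtain ⟨G, hG⟩ := exists_homeomorph_eventuallyEq hRc (D := D)
    (by
      filter_upwards [hRU] with z hz
      exact (hasFDerivWithinAt_inter (hU.mem_nhds hz.2)).1
        (hf.differentiableOn one_ne_zero z hz).hasFDerivWithinAt)
    ((continuousWithinAt_inter hUx).1 hDc) hinv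
  have hGx : f x₀ = G x₀ := hG.eq_of_nhdsWithin hx₀.1
  have htendsto : Tendsto G.symm (𝓝[R'] (f x₀)) (𝓝[R] x₀) := by
    rw [hGx]
    refine tendsto_homeomorph_symm_nhdsWithin hR ?_ hRc' hRi' G hx₀.1 ?_
    · rw [hRc.closure_interior_eq_closure_of_nonempty_interior hRi]
      exact subset_closure
    · filter_upwards [hG, hRU] with z hz hzU
      exact hz ▸ ⟨hmaps hzU, hfr z hzU⟩
  obtain ⟨V, hVo, hxV, hV⟩ := mem_nhdsWithin.1
    (htendsto (inter_mem (inter_mem hRU hG) hinv_near))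
  rw [inter_comm] at hV
  have hgs : MapsTo G.symm (R' ∩ V) (R ∩ U) := fun y hy => (hV hy).1.1
  have hfg : RightInvOn G.symm f (R' ∩ V) := fun y hy =>
    (hV hy).1.2.trans (G.apply_symm_apply y)
  exact ⟨G.symm, V, hVo, hxV, by rw [hGx, G.symm_apply_apply], hgs, hfg,
    contDiffOn_one_of_rightInvOn hs ((uniqueDiffOn_convex hRc' hRi').inter hVo) hf
      G.symm.continuous.continuousOn hgs hfg fun y hy => (hV hy).2⟩

end LocalInverse

section LocalInverseManifold

variable {E : Type*} [NormedAddCommGroup E] [NormedSpace ℝ E]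
  {H : Type*} [TopologicalSpace H] {I : ModelWithCorners ℝ E H}
  {E' : Type*} [NormedAddCommGroup E'] [NormedSpace ℝ E']
  {H' : Type*} [TopologicalSpace H'] {I' : ModelWithCorners ℝ E' H'}
  {S : Type*} [TopologicalSpace S] [ChartedSpace H S] [IsManifold I 1 S]
  {M : Type*} [TopologicalSpace M] [ChartedSpace H' M] [IsManifold I' 1 M]

theorem mem_boundary_iff_extChartAt_mem_frontier {x p : S} (hp : p ∈ (extChartAt I x).source) :
    p ∈ I.boundary S ↔ extChartAt I x p ∈ frontier (range I) := by
  have hp' : p ∈ (chartAt H x).source := by rwa [extChartAt_source] at hp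
  have hint : p ∈ I.interior S ↔ extChartAt I x p ∈ interior (range I) :=
    (I.isInteriorPoint_iff_of_mem_atlas one_ne_zero (chart_mem_atlas H x) hp').trans
      ⟨fun h => interior_mono (extChartAt_target_subset_range x) h,
        fun h => (chartAt H x).mem_interior_extend_target ((chartAt H x).map_source hp') h⟩
  rw [← I.compl_interior, mem_compl_iff, hint, I.isClosed_range.frontier_eq]
  exact (and_iff_right (extChartAt_target_subset_range x ((extChartAt I x).map_source hp))).symm

theorem exists_contMDiffOn_localInverse [FiniteDimensional ℝ E] [FiniteDimensional ℝ E'] {f : S → M}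
    (hf : ContMDiff I I' 1 f) {x : S} (hinv : (mfderiv I I' f x).IsInvertible)
    (hbd : ∀ z, f z ∈ I'.boundary M ↔ z ∈ I.boundary S) :
    ∃ (g : M → S) (V : Set M), IsOpen V ∧ f x ∈ V ∧ g (f x) = x ∧ RightInvOn g f V ∧
      ContMDiffOn I' I 1 g V := by
  set φ := extChartAt I x
  set φ' := extChartAt I' (f x)
  obtain ⟨U, hUo, hxU, hU⟩ : ∃ U : Set E, IsOpen U ∧ φ x ∈ U ∧
      U ∩ range I ⊆ φ.target ∩ φ.symm ⁻¹' (f ⁻¹' φ'.source) := by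
    refine mem_nhdsWithin.1 (inter_mem (extChartAt_target_mem_nhdsWithin x)
      (mem_nhdsWithin_of_mem_nhds (extChartAt_preimage_mem_nhds ?_)))
    exact hf.continuous.continuousAt.preimage_mem_nhds (extChartAt_source_mem_nhds _)
  rw [inter_comm] at hU
  obtain ⟨g, V, hVo, hxV, hgx, hgm, hfg, hg⟩ := exists_contDiffOn_localInverse
    (R' := range I') (x₀ := φ x) I.isClosed_range I.convex_range I.nonempty_interior I'.convex_range
    I'.nonempty_interior hUo ⟨mem_range_self _, hxU⟩ (((contMDiff_iff.1 hf).2 x (f x)).mono hU)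
    (by rwa [(hf.mdifferentiableAt one_ne_zero).mfderiv] at hinv)
    (fun z hz => extChartAt_target_subset_range _ (φ'.map_source (hU hz).2))
    (fun z hz => by
      have hf_bd := mem_boundary_iff_extChartAt_mem_frontier (I := I') (hU hz).2
      have hz_bd := mem_boundary_iff_extChartAt_mem_frontier (I := I) (φ.map_target (hU hz).1)
      rw [φ.right_inv (hU hz).1] at hz_bd
      exact hf_bd.symm.trans ((hbd _).trans hz_bd))
  rw [Function.comp_apply, Function.comp_apply, extChartAt_to_inv] at hxV hgx
  have hmem : MapsTo φ' (φ'.source ∩ φ' ⁻¹' V) (range I' ∩ V) := fun y hy =>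
    ⟨extChartAt_target_subset_range _ (φ'.map_source hy.1), hy.2⟩
  refine ⟨φ.symm ∘ g ∘ φ', φ'.source ∩ φ' ⁻¹' V, isOpen_extChartAt_preimage' (f x) hVo,
    ⟨mem_extChartAt_source _, hxV⟩, ?_, fun y hy => ?_, ?_⟩
  · rw [Function.comp_apply, Function.comp_apply, hgx, extChartAt_to_inv]
  · exact φ'.injOn (hU (hgm (hmem hy))).2 hy.1 (hfg (hmem hy))
  · refine (contMDiffOn_extChartAt_symm (I := I) (n := 1) x).comp (t := φ.target) ?_
      fun y hy => (hU (hgm (hmem hy))).1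
    refine (contMDiffOn_iff_contDiffOn.2 hg).comp (t := range I' ∩ V) ?_ hmem
    exact contMDiffOn_extChartAt.mono fun y hy => by
      simpa only [φ', extChartAt_source] using hy.1

end LocalInverseManifold

/- Ekeland's variational principle: the sets `T x` of points reachable from `x` by a descent of
rate `1` are closed and nested, and can be chosen to shrink to a point. -/
theorem exists_forall_dist_le_sub_imp_eq {X : Type*} [MetricSpace X] [CompleteSpace X] [Nonempty X]
    {φ : X → ℝ} (hφ : LowerSemicontinuous φ) (hbdd : BddBelow (range φ)) :
    ∃ x, ∀ y, dist x y ≤ φ x - φ y → y = x := by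
  let T : X → Set X := fun x => {y | dist x y ≤ φ x - φ y}
  have hT_trans : ∀ {x y z}, y ∈ T x → z ∈ T y → z ∈ T x := fun {x y z} hxy hyz => by
    simp only [T, mem_ofPred_eq] at *
    linarith [dist_triangle x y z]
  have hT_closed : ∀ x, IsClosed (T x) := fun x => by
    have hlsc : LowerSemicontinuous fun y => dist x y + φ y :=
      (continuous_const.dist continuous_id).lowerSemicontinuous.add hφ
    have hT_eq : T x = (fun y => dist x y + φ y) ⁻¹' Iic (φ x) := by
      ext y
      simp only [T, mem_ofPred_eq, mem_preimage, mem_Iic, le_sub_iff_add_le]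
    exact hT_eq ▸ hlsc.isClosed_preimage (φ x)
  have hT_shrink : ∀ (x : X) (k : ℕ), ∃ y ∈ T x, ∀ z ∈ T y, dist y z ≤ (1 / 2) ^ k := by
    intro x k
    have hbddT : BddBelow (φ '' T x) := hbdd.mono (image_subset_range φ _)
    obtain ⟨_, ⟨y, hy, rfl⟩, hlt⟩ := Real.lt_sInf_add_pos (s := φ '' T x)
      ⟨φ x, x, by simp [T], rfl⟩ (pow_pos one_half_pos k)
    refine ⟨y, hy, fun z hz => ?_⟩
    have hinf : sInf (φ '' T x) ≤ φ z := csInf_le hbddT ⟨z, hT_trans hy hz, rfl⟩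
    simp only [T, mem_ofPred_eq] at hz
    linarith
  choose next hnext hnext_dist using hT_shrink
  obtain ⟨x₀⟩ := ‹Nonempty X›
  let u : ℕ → X := fun k => Nat.rec x₀ (fun k x => next x k) k
  have hu : ∀ k l, k ≤ l → u l ∈ T (u k) := fun k l hkl => by
    induction l, hkl using Nat.le_induction with
    | base => simp [T]
    | succ l _ ih => exact hT_trans ih (hnext (u l) l)
  have hu_dist : ∀ k, ∀ z ∈ T (u (k + 1)), dist (u (k + 1)) z ≤ (1 / 2) ^ k := fun k =>
    hnext_dist (u k) k
  have hpow : Tendsto (fun k : ℕ => (1 / 2 : ℝ) ^ k) atTop (𝓝 0) :=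
    tendsto_pow_atTop_nhds_zero_of_lt_one one_half_pos.le one_half_lt_one
  have hcauchy : CauchySeq fun k => u (k + 1) :=
    cauchySeq_of_le_tendsto_0' _ (fun k l hkl => hu_dist k _ (hu _ _ (Nat.succ_le_succ hkl))) hpow
  obtain ⟨x, hx⟩ := cauchySeq_tendsto_of_complete hcauchy
  have hxT : ∀ k, x ∈ T (u (k + 1)) := fun k => (hT_closed _).mem_of_tendsto hx
    (eventually_atTop.2 ⟨k, fun l hl => hu _ _ (Nat.succ_le_succ hl)⟩)
  refine ⟨x, fun y hy => tendsto_nhds_unique ?_ hx⟩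
  exact tendsto_iff_dist_tendsto_zero.2 (squeeze_zero (fun _ => dist_nonneg)
    (fun k => hu_dist k y (hT_trans (hxT k) hy)) hpow)

section LocalIsometry

open scoped ENNReal

variable {E : Type*} [NormedAddCommGroup E] [NormedSpace ℝ E]
  {H : Type*} [TopologicalSpace H] {I : ModelWithCorners ℝ E H}
  {E' : Type*} [NormedAddCommGroup E'] [NormedSpace ℝ E']
  {H' : Type*} [TopologicalSpace H'] {I' : ModelWithCorners ℝ E' H'}
  {S : Type*} [MetricSpace S] [ChartedSpace H S]
  [RiemannianBundle (fun x : S => TangentSpace I x)]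
  {M : Type*} [MetricSpace M] [ChartedSpace H' M]
  [RiemannianBundle (fun x : M => TangentSpace I' x)]

theorem pathELength_comp_of_norm_mfderiv_eq {f : S → M} (hf : MDifferentiable I I' f)
    (hiso : ∀ x (v : TangentSpace I x), ‖mfderiv I I' f x v‖ = ‖v‖) {γ : ℝ → S} {a b : ℝ}
    (hγ : MDifferentiableOn 𝓘(ℝ, ℝ) I γ (Icc a b)) :
    pathELength I' (f ∘ γ) a b = pathELength I γ a b := by
  rcases le_or_gt b a with hab | hab
  · simp only [pathELength_eq_lintegral_mfderiv_Ioo, Ioo_eq_empty hab.not_gt,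
      MeasureTheory.Measure.restrict_empty, MeasureTheory.lintegral_zero_measure]
  rw [pathELength_eq_lintegral_mfderivWithin_Icc, pathELength_eq_lintegral_mfderivWithin_Icc]
  refine MeasureTheory.setLIntegral_congr_fun measurableSet_Icc fun t ht => ?_
  have hchain : mfderivWithin 𝓘(ℝ, ℝ) I' (f ∘ γ) (Icc a b) t =
      (mfderiv I I' f (γ t)).comp (mfderivWithin 𝓘(ℝ, ℝ) I γ (Icc a b) t) :=
    mfderiv_comp_mfderivWithin t (hf _) (hγ t ht)
      (uniqueMDiffWithinAt_iff_uniqueDiffWithinAt.2 (uniqueDiffOn_Icc hab t ht))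
  have hchain_one : mfderivWithin 𝓘(ℝ, ℝ) I' (f ∘ γ) (Icc a b) t 1 =
      mfderiv I I' f (γ t) (mfderivWithin 𝓘(ℝ, ℝ) I γ (Icc a b) t 1) := congr($hchain 1)
  rw [hchain_one, ← ofReal_norm, ← ofReal_norm]
  exact congrArg ENNReal.ofReal (hiso (γ t) _)

theorem isInvertible_mfderiv_of_norm_eq [FiniteDimensional ℝ E] [FiniteDimensional ℝ E']
    (hdim : Module.finrank ℝ E = Module.finrank ℝ E') {f : S → M} {x : S}
    (hiso : ∀ v : TangentSpace I x, ‖mfderiv I I' f x v‖ = ‖v‖) :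
    (mfderiv I I' f x).IsInvertible := by
  let L : E →L[ℝ] E' := mfderiv I I' f x
  have hinj : Function.Injective (mfderiv I I' f x) :=
    (injective_iff_map_eq_zero _).2 fun v hv => by rw [← norm_eq_zero, ← hiso v, hv, norm_zero]
  exact ⟨(LinearMap.linearEquivOfInjective L.toLinearMap hinj hdim).toContinuousLinearEquiv, rfl⟩

variable [IsRiemannianManifold I' M]

theorem edist_le_pathELength {γ : ℝ → M} {a b : ℝ}
    (hγ : ContMDiffOn 𝓘(ℝ, ℝ) I' 1 γ (Icc a b)) (hab : a ≤ b) :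
    edist (γ a) (γ b) ≤ pathELength I' γ a b := by
  rw [IsRiemannianManifold.out (I := I')]
  exact riemannianEDist_le_pathELength hγ rfl rfl hab

theorem exists_pathELength_lt_of_dist_lt {x y : M} {r : ℝ} (hr : dist x y < r) :
    ∃ γ : ℝ → M, γ 0 = x ∧ γ 1 = y ∧ ContMDiffOn 𝓘(ℝ, ℝ) I' 1 γ (Icc 0 1) ∧
      pathELength I' γ 0 1 < ENNReal.ofReal r := by
  refine exists_lt_of_riemannianEDist_lt ?_
  rw [← IsRiemannianManifold.out (I := I'), edist_dist]
  exact (ENNReal.ofReal_lt_ofReal_iff (dist_nonneg.trans_lt hr)).2 hr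

theorem exists_between_dist_add_dist_lt (I' : ModelWithCorners ℝ E' H')
    [RiemannianBundle (fun x : M => TangentSpace I' x)] [IsRiemannianManifold I' M] {x y : M}
    {ρ ε : ℝ} (hρ : 0 ≤ ρ) (hρd : ρ ≤ dist x y) (hε : 0 < ε) :
    ∃ z, dist x z = ρ ∧ dist x z + dist z y < dist x y + ε := by
  obtain ⟨γ, rfl, rfl, hγ, hlen⟩ :=
    exists_pathELength_lt_of_dist_lt (I' := I') (lt_add_of_pos_right (dist x y) hε)
  obtain ⟨τ, hτ, hτρ⟩ : ∃ τ ∈ Icc (0 : ℝ) 1, dist (γ 0) (γ τ) = ρ :=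
    intermediate_value_Icc zero_le_one
      ((continuous_const.dist continuous_id).comp_continuousOn hγ.continuousOn) ⟨by simpa, hρd⟩
  refine ⟨γ τ, hτρ, ?_⟩
  have hbefore := edist_le_pathELength (hγ.mono (Icc_subset_Icc_right hτ.2)) hτ.1
  have hafter := edist_le_pathELength (hγ.mono (Icc_subset_Icc_left hτ.1)) hτ.2
  rw [← ENNReal.ofReal_lt_ofReal_iff (by positivity), ENNReal.ofReal_add dist_nonneg dist_nonneg,
    ← edist_dist, ← edist_dist]
  refine lt_of_le_of_lt ?_ hlen
  rw [← pathELength_add hτ.1 hτ.2]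
  exact add_le_add hbefore hafter

variable [IsRiemannianManifold I S] [FiniteDimensional ℝ E] [FiniteDimensional ℝ E']
  [IsManifold I 1 S] [IsManifold I' 1 M]

theorem exists_lift_dist_le (hdim : Module.finrank ℝ E = Module.finrank ℝ E') {f : S → M}
    (hf : ContMDiff I I' 1 f) (hiso : ∀ x (v : TangentSpace I x), ‖mfderiv I I' f x v‖ = ‖v‖)
    (hbd : ∀ z, f z ∈ I'.boundary M ↔ z ∈ I.boundary S) (x : S) :
    ∃ δ > 0, ∀ y, dist (f x) y < δ → ∃ x', f x' = y ∧ dist x x' ≤ 2 * dist (f x) y := by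
  obtain ⟨g, V, hVo, hxV, hgx, hfg, hg⟩ :=
    exists_contMDiffOn_localInverse hf (isInvertible_mfderiv_of_norm_eq hdim (hiso x)) hbd
  obtain ⟨δ, hδ, hδV⟩ := Metric.isOpen_iff.1 hVo _ hxV
  refine ⟨δ, hδ, fun y hy => ?_⟩
  rcases eq_or_ne (f x) y with rfl | hne
  · exact ⟨x, rfl, by simp⟩
  have hdist : 0 < dist (f x) y := dist_pos.2 hne
  obtain ⟨γ, hγ0, rfl, hγ, hlen⟩ := exists_pathELength_lt_of_dist_lt (I' := I')
    (r := min δ (2 * dist (f x) y)) (lt_min hy (by linarith))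
  have hγV : MapsTo γ (Icc 0 1) V := fun t ht => by
    refine hδV (mem_ball'.2 ?_)
    rw [← ENNReal.ofReal_lt_ofReal_iff hδ, ← edist_dist, ← hγ0]
    calc edist (γ 0) (γ t) ≤ pathELength I' γ 0 t :=
          edist_le_pathELength (hγ.mono (Icc_subset_Icc_right ht.2)) ht.1
      _ ≤ pathELength I' γ 0 1 := pathELength_mono le_rfl ht.2
      _ < ENNReal.ofReal (min δ (2 * dist (f x) (γ 1))) := hlen
      _ ≤ ENNReal.ofReal δ := ENNReal.ofReal_le_ofReal (min_le_left _ _)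
  have hgγ : ContMDiffOn 𝓘(ℝ, ℝ) I 1 (g ∘ γ) (Icc 0 1) := hg.comp hγ hγV
  refine ⟨g (γ 1), hfg (hγV (right_mem_Icc.2 zero_le_one)), ?_⟩
  rw [← ENNReal.ofReal_le_ofReal_iff (by positivity), ← edist_dist]
  calc edist x (g (γ 1)) = edist ((g ∘ γ) 0) ((g ∘ γ) 1) := by
        rw [Function.comp_apply, Function.comp_apply, hγ0, hgx]
    _ ≤ pathELength I (g ∘ γ) 0 1 := edist_le_pathELength hgγ zero_le_one
    _ = pathELength I' (f ∘ g ∘ γ) 0 1 := (pathELength_comp_of_norm_mfderiv_eq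
        (hf.mdifferentiable one_ne_zero) hiso (hgγ.mdifferentiableOn one_ne_zero)).symm
    _ = pathELength I' γ 0 1 := pathELength_congr fun t ht => hfg (hγV ht)
    _ ≤ ENNReal.ofReal (2 * dist (f x) (γ 1)) :=
        hlen.le.trans (ENNReal.ofReal_le_ofReal (min_le_right _ _))

/- If `f x ≠ q`, a short step from `f x` towards `q` lifts to `S` and decreases the distance to `q`
at a definite rate, so `x` is not a point given by Ekeland's principle. -/
theorem surjective_of_norm_mfderiv_eq [CompleteSpace S] [Nonempty S]
    (hdim : Module.finrank ℝ E = Module.finrank ℝ E') {f : S → M} (hf : ContMDiff I I' 1 f)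
    (hiso : ∀ x (v : TangentSpace I x), ‖mfderiv I I' f x v‖ = ‖v‖)
    (hbd : ∀ z, f z ∈ I'.boundary M ↔ z ∈ I.boundary S) : Function.Surjective f := by
  intro q
  have hcont : Continuous fun x => 4 * dist (f x) q :=
    continuous_const.mul (hf.continuous.dist continuous_const)
  obtain ⟨x, hx⟩ := exists_forall_dist_le_sub_imp_eq hcont.lowerSemicontinuous
    ⟨0, by rintro _ ⟨y, rfl⟩; positivity⟩
  refine ⟨x, ?_⟩
  by_contra hne
  obtain ⟨δ, hδ, hlift⟩ := exists_lift_dist_le hdim hf hiso hbd x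
  obtain ⟨ρ, hρ, hρlt⟩ := exists_between (lt_min hδ (dist_pos.2 hne))
  obtain ⟨z, hzρ, hz⟩ := exists_between_dist_add_dist_lt I' hρ.le
    (hρlt.le.trans (min_le_right _ _)) (half_pos hρ)
  obtain ⟨x', rfl, hx'⟩ := hlift z (hzρ ▸ hρlt.trans_le (min_le_left _ _))
  have hxx' : x' = x := hx x' (by linarith)
  rw [hxx', dist_self] at hzρ
  exact hρ.ne hzρ

end LocalIsometry

section MetricTensor

variable {E : Type*} [NormedAddCommGroup E] [NormedSpace ℝ E]
  {H : Type*} [TopologicalSpace H] {I : ModelWithCorners ℝ E H}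
  {P : Type*} [TopologicalSpace P] [ChartedSpace H P]

/-- A field of symmetric bilinear forms on the tangent spaces whose coefficients in the preferred
chart around each point are differentiable at that point: what is needed of a metric tensor for its
Christoffel symbols to be meaningful. -/
structure IsDifferentiableMetric (g : ∀ x : P, TangentSpace I x → TangentSpace I x → ℝ) :
    Prop where
  bilinear : ∀ x, IsBilinearMap ℝ (g x)
  symm : ∀ x v w, g x v w = g x w v
  differentiableWithinAt : ∀ x v w,
    DifferentiableWithinAt ℝ (coordMetric g x v w) (range I) (extChartAt I x x)

theorem coordMetric_mfderiv [IsManifold I 1 P]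
    (g : ∀ x : P, TangentSpace I x → TangentSpace I x → ℝ) {x p : P}
    (hp : p ∈ (extChartAt I x).source) (X Y : TangentSpace I p) :
    coordMetric g x (mfderiv I 𝓘(ℝ, E) (extChartAt I x) p X)
      (mfderiv I 𝓘(ℝ, E) (extChartAt I x) p Y) (extChartAt I x p) = g p X Y := by
  have hinv := mfderivWithin_extChartAt_symm_comp_mfderiv_extChartAt' (I := I) hp
  have htransport : ∀ q : P, q = p → ∀ v w : E, v = X → w = Y →
      g q (show TangentSpace I q from v) (show TangentSpace I q from w) = g p X Y := by
    rintro q rfl v w rfl rfl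
    rfl
  exact htransport _ ((extChartAt I x).left_inv hp) _ _ congr($hinv X) congr($hinv Y)

theorem coordMetric_self [IsManifold I 1 P] (g : ∀ x : P, TangentSpace I x → TangentSpace I x → ℝ)
    (x : P) (v w : TangentSpace I x) :
    coordMetric g x v w (extChartAt I x x) = g x v w := by
  have hid : ∀ v, mfderiv I 𝓘(ℝ, E) (extChartAt I x) x v = v := fun v =>
    congr($(mfderiv_extChartAt_self (I := I) (x := x)) v)
  have h := coordMetric_mfderiv g (mem_extChartAt_source (I := I) x) v w
  rwa [hid, hid] at h

theorem differentiableWithinAt_clm_of_forall_apply {V W W' : Type*}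
    [NormedAddCommGroup V] [NormedSpace ℝ V] [NormedAddCommGroup W] [NormedSpace ℝ W]
    [NormedAddCommGroup W'] [NormedSpace ℝ W'] [FiniteDimensional ℝ W] {f : V → W →L[ℝ] W'}
    {s : Set V} {x : V} (hf : ∀ w, DifferentiableWithinAt ℝ (fun y => f y w) s x) :
    DifferentiableWithinAt ℝ f s x := by
  let e₁ := ContinuousLinearEquiv.ofFinrankEq (𝕜 := ℝ) (E := W)
    (F := Fin (Module.finrank ℝ W) → ℝ) (Module.finrank_fin_fun ℝ).symm
  let e₂ := (e₁.arrowCongr (1 : W' ≃L[ℝ] W')).trans (ContinuousLinearEquiv.piRing _)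
  rw [← Function.id_comp f, ← e₂.symm_comp_self]
  exact e₂.symm.differentiableAt.comp_differentiableWithinAt x
    (differentiableWithinAt_pi.2 fun i => hf _)

theorem dMetric_zero_left (g : ∀ x : P, TangentSpace I x → TangentSpace I x → ℝ) (x : P)
    (v w : E) : dMetric g x 0 v w = 0 :=
  map_zero (fderivWithin ℝ (coordMetric g x v w) (range I) (extChartAt I x x))

variable {g : ∀ x : P, TangentSpace I x → TangentSpace I x → ℝ}

theorem dMetric_zero_middle (hg : ∀ x, IsBilinearMap ℝ (g x)) (x : P) (u w : E) :
    dMetric g x u 0 w = 0 := by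
  have hzero : coordMetric g x 0 w = fun _ => 0 := funext fun y =>
    (congrArg (g _ · _) (map_zero _)).trans ((hg _).toLinearMap.map_zero₂ _)
  rw [dMetric, hzero, fderivWithin_fun_const]
  rfl

theorem dMetric_zero_right (hg : ∀ x, IsBilinearMap ℝ (g x)) (x : P) (u v : E) :
    dMetric g x u v 0 = 0 := by
  have hzero : coordMetric g x v 0 = fun _ => 0 := funext fun y =>
    (congrArg (g _ _) (map_zero _)).trans ((hg _).toLinearMap _).map_zero
  rw [dMetric, hzero, fderivWithin_fun_const]
  rfl

theorem christoffel_zero_middle (hg : ∀ x, IsBilinearMap ℝ (g x)) (x : P) (u w : E) :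
    christoffel g x u 0 w = 0 := by
  simp only [christoffel, dMetric_zero_left, dMetric_zero_middle hg, dMetric_zero_right hg,
    add_zero, sub_zero, zero_div]

theorem christoffel_zero_right (hg : ∀ x, IsBilinearMap ℝ (g x)) (x : P) (u v : E) :
    christoffel g x u v 0 = 0 := by
  simp only [christoffel, dMetric_zero_left, dMetric_zero_right hg, add_zero, sub_zero, zero_div]

namespace IsDifferentiableMetric

theorem dMetric_comm (hg : IsDifferentiableMetric g) (x : P) (u v w : E) :
    dMetric g x u v w = dMetric g x u w v := by
  have hsymm : coordMetric g x v w = coordMetric g x w v := funext fun y => hg.symm _ _ _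
  rw [dMetric, dMetric, hsymm]

theorem christoffel_add_christoffel (hg : IsDifferentiableMetric g) (x : P) (u v w : E) :
    christoffel g x u v w + christoffel g x u w v = dMetric g x u v w := by
  rw [christoffel, christoffel, hg.dMetric_comm x w u v, hg.dMetric_comm x v u w,
    hg.dMetric_comm x u w v]
  ring

variable [FiniteDimensional ℝ E]

/-- The coefficients of the metric at the point `y` of the preferred chart around `x`, as a
continuous bilinear form. -/
noncomputable def coordForm (hg : IsDifferentiableMetric g) (x : P) (y : E) :
    E →L[ℝ] E →L[ℝ] ℝ :=
  let L : E →ₗ[ℝ] TangentSpace I ((extChartAt I x).symm y) :=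
    (mfderivWithin 𝓘(ℝ, E) I (extChartAt I x).symm (range I) y).toLinearMap
  ((hg.bilinear ((extChartAt I x).symm y)).toLinearMap.compl₁₂ L L).toContinuousBilinearMap

theorem coordForm_self [IsManifold I 1 P] (hg : IsDifferentiableMetric g) (x : P)
    (v w : TangentSpace I x) : hg.coordForm x (extChartAt I x x) v w = g x v w :=
  coordMetric_self g x v w

set_option maxSynthPendingDepth 3 in
theorem exists_hasFDerivWithinAt_coordForm (hg : IsDifferentiableMetric g) (x : P) :
    ∃ D : E →L[ℝ] E →L[ℝ] E →L[ℝ] ℝ,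
      HasFDerivWithinAt (hg.coordForm x) D (range I) (extChartAt I x x) ∧
        ∀ u v w, dMetric g x u v w = D u v w := by
  have hdiff : DifferentiableWithinAt ℝ (hg.coordForm x) (range I) (extChartAt I x x) :=
    differentiableWithinAt_clm_of_forall_apply fun v =>
      differentiableWithinAt_clm_of_forall_apply fun w => hg.differentiableWithinAt x v w
  refine ⟨_, hdiff.hasFDerivWithinAt, fun u v w => ?_⟩
  have hvw := (hdiff.hasFDerivWithinAt.clm_apply (hasFDerivWithinAt_const v _ _)).clm_apply
    (hasFDerivWithinAt_const w _ _)
  exact congr($(hvw.fderivWithin (I.uniqueDiffOn _ (mem_range_self _))) u).trans (by simp)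

set_option maxSynthPendingDepth 3 in
theorem christoffel_sub_smul (hg : IsDifferentiableMetric g) (x : P) (u v w w' : E) (c : ℝ) :
    christoffel g x u v (w - c • w') = christoffel g x u v w - c * christoffel g x u v w' := by
  obtain ⟨D, -, hD⟩ := hg.exists_hasFDerivWithinAt_coordForm x
  simp only [christoffel, hD, map_sub, map_smul, sub_apply, smul_apply, smul_eq_mul]
  ring

set_option maxSynthPendingDepth 3 in
theorem fderivWithin_coordMetric [IsManifold I 1 P] (hg : IsDifferentiableMetric g)
    {V : Type*} [NormedAddCommGroup V] [NormedSpace ℝ V] {x : P} {f A B : V → E} {R : Set V} {z : V}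
    (hR : UniqueDiffWithinAt ℝ R z) (hf : DifferentiableWithinAt ℝ f R z)
    (hfx : f z = extChartAt I x x) (hfR : ∀ᶠ y in 𝓝[R] z, f y ∈ range I)
    (hA : DifferentiableWithinAt ℝ A R z) (hB : DifferentiableWithinAt ℝ B R z) (u : V) :
    fderivWithin ℝ (fun y => coordMetric g x (A y) (B y) (f y)) R z u =
      dMetric g x (fderivWithin ℝ f R z u) (A z) (B z) + g x (fderivWithin ℝ A R z u) (B z) +
        g x (A z) (fderivWithin ℝ B R z u) := by
  obtain ⟨D, hform, hD⟩ := hg.exists_hasFDerivWithinAt_coordForm x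
  have hcomp := (hfx ▸ hform).comp_of_tendsto z hf.hasFDerivWithinAt
    (tendsto_nhdsWithin_iff.2 ⟨hf.continuousWithinAt, hfR⟩)
  have hprod := (hcomp.clm_apply hA.hasFDerivWithinAt).clm_apply hB.hasFDerivWithinAt
  have hself : ∀ a b : E, g x a b = hg.coordForm x (f z) a b := fun a b => by
    rw [hfx]
    exact (hg.coordForm_self x a b).symm
  refine congr($(hprod.fderivWithin hR) u).trans ?_
  rw [hD, hself, hself]
  simp only [add_apply, ContinuousLinearMap.comp_apply, ContinuousLinearMap.flip_apply,
    Function.comp_apply]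
  ring

end IsDifferentiableMetric

end MetricTensor

section Immersion

variable {E : Type*} [NormedAddCommGroup E] [NormedSpace ℝ E]
  {H : Type*} [TopologicalSpace H] {I : ModelWithCorners ℝ E H}
  {S : Type*} [TopologicalSpace S] [ChartedSpace H S]
  {E' : Type*} [NormedAddCommGroup E'] [NormedSpace ℝ E']
  {H' : Type*} [TopologicalSpace H'] {J : ModelWithCorners ℝ E' H'}
  {P : Type*} [TopologicalSpace P] [ChartedSpace H' P] {F : S → P}

variable (I J) in
/-- The second derivative at `x`, in the directions `u` and `v`, of the expression of `F` in the
preferred charts around `x` and `F x`. It depends on the charts; the Gauss and Weingarten formulas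
below combine it with Christoffel symbols in the same charts. -/
noncomputable def sndDerivInCharts (F : S → P) (x : S) (u v : TangentSpace I x) :
    TangentSpace J (F x) :=
  (fderivWithin ℝ (fderivWithin ℝ (writtenInExtChartAt I J x F) (range I)) (range I)
    (extChartAt I x x) : E →L[ℝ] E →L[ℝ] E') u v

theorem hasFDerivWithinAt_fderivWithin_writtenInExtChartAt (hF : ContMDiff I J 2 F) (x : S) :
    HasFDerivWithinAt (fderivWithin ℝ (writtenInExtChartAt I J x F) (range I))
      (fderivWithin ℝ (fderivWithin ℝ (writtenInExtChartAt I J x F) (range I)) (range I)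
        (extChartAt I x x)) (range I) (extChartAt I x x) :=
  (((contMDiffAt_iff.1 (hF x)).2.fderivWithin_right (m := 1) I.uniqueDiffOn le_rfl
    (mem_range_self _)).differentiableWithinAt one_ne_zero).hasFDerivWithinAt

theorem hasFDerivWithinAt_fderivWithin_writtenInExtChartAt_apply (hF : ContMDiff I J 2 F) (x : S)
    (v : E) :
    HasFDerivWithinAt (fun z => fderivWithin ℝ (writtenInExtChartAt I J x F) (range I) z v)
      ((fderivWithin ℝ (fderivWithin ℝ (writtenInExtChartAt I J x F) (range I)) (range I)
        (extChartAt I x x)).flip v) (range I) (extChartAt I x x) := by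
  simpa using (hasFDerivWithinAt_fderivWithin_writtenInExtChartAt hF x).clm_apply
    (hasFDerivWithinAt_const v _ _)

theorem sndDerivInCharts_comm (hF : ContMDiff I J 2 F) (x : S) (u v : TangentSpace I x) :
    sndDerivInCharts I J F x u v = sndDerivInCharts I J F x v u :=
  (contMDiffAt_iff.1 (hF x)).2.isSymmSndFDerivWithinAt (by simp) I.uniqueDiffOn
    (I.range_subset_closure_interior (mem_range_self _)) (mem_range_self _) u v

theorem fderivWithin_writtenInExtChartAt_self (hF : ContMDiff I J 2 F) (x : S)
    (v : TangentSpace I x) :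
    fderivWithin ℝ (writtenInExtChartAt I J x F) (range I) (extChartAt I x x) v =
      mfderiv I J F x v :=
  congr($((hF.mdifferentiableAt two_ne_zero).mfderiv) v).symm

theorem eventually_mem_target_and_mem_source (hF : Continuous F) (x : S) :
    ∀ᶠ z in 𝓝[range I] (extChartAt I x x), z ∈ (extChartAt I x).target ∧
      F ((extChartAt I x).symm z) ∈ (extChartAt J (F x)).source :=
  inter_mem (extChartAt_target_mem_nhdsWithin x) (mem_nhdsWithin_of_mem_nhds
    (extChartAt_preimage_mem_nhds
      (hF.continuousAt.preimage_mem_nhds (extChartAt_source_mem_nhds _))))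

variable [IsManifold J 1 P] {g : ∀ y : P, TangentSpace J y → TangentSpace J y → ℝ}

theorem fderivWithin_coordMetric_writtenInExtChartAt [FiniteDimensional ℝ E']
    (hg : IsDifferentiableMetric g)
    (hF : ContMDiff I J 2 F) (x : S) {A B : E → E'}
    (hA : DifferentiableWithinAt ℝ A (range I) (extChartAt I x x))
    (hB : DifferentiableWithinAt ℝ B (range I) (extChartAt I x x)) (u : TangentSpace I x) :
    fderivWithin ℝ (fun z => coordMetric g (F x) (A z) (B z) (writtenInExtChartAt I J x F z))
        (range I) (extChartAt I x x) u =
      dMetric g (F x) (mfderiv I J F x u) (A (extChartAt I x x)) (B (extChartAt I x x)) +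
        g (F x) (fderivWithin ℝ A (range I) (extChartAt I x x) u) (B (extChartAt I x x)) +
        g (F x) (A (extChartAt I x x)) (fderivWithin ℝ B (range I) (extChartAt I x x) u) := by
  rw [← fderivWithin_writtenInExtChartAt_self hF]
  refine hg.fderivWithin_coordMetric (I.uniqueDiffOn _ (mem_range_self _))
    ((contMDiffAt_iff.1 (hF x)).2.differentiableWithinAt two_ne_zero) (by simp) ?_ hA hB u
  filter_upwards [eventually_mem_target_and_mem_source (J := J) hF.continuous x] with z hz
  exact extChartAt_target_subset_range _ ((extChartAt J (F x)).map_source hz.2)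

variable [IsManifold I 1 S]

theorem fderivWithin_writtenInExtChartAt (hF : ContMDiff I J 2 F) {x : S} {z : E}
    (hz : z ∈ (extChartAt I x).target)
    (hFz : F ((extChartAt I x).symm z) ∈ (extChartAt J (F x)).source) (v : E) :
    fderivWithin ℝ (writtenInExtChartAt I J x F) (range I) z v =
      mfderiv J 𝓘(ℝ, E') (extChartAt J (F x)) (F ((extChartAt I x).symm z))
        (mfderiv I J F ((extChartAt I x).symm z)
          (mfderivWithin 𝓘(ℝ, E) I (extChartAt I x).symm (range I) z v)) := by
  have hchart : MDifferentiableAt J 𝓘(ℝ, E') (extChartAt J (F x)) (F ((extChartAt I x).symm z)) :=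
    mdifferentiableAt_extChartAt (by rwa [← extChartAt_source J])
  have hmap := hF.mdifferentiableAt two_ne_zero (x := (extChartAt I x).symm z)
  have hcomp := mfderiv_comp_mfderivWithin z (hchart.comp _ hmap)
    (mdifferentiableWithinAt_extChartAt_symm hz)
    (I.uniqueMDiffOn _ (extChartAt_target_subset_range _ hz))
  rw [mfderiv_comp _ hchart hmap] at hcomp
  have hmfderiv : mfderivWithin 𝓘(ℝ, E) 𝓘(ℝ, E') (writtenInExtChartAt I J x F) (range I) z =
      fderivWithin ℝ (writtenInExtChartAt I J x F) (range I) z := mfderivWithin_eq_fderivWithin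
  exact congr($hmfderiv v).symm.trans congr($hcomp v)

variable (g) in
theorem coordMetric_fderivWithin_writtenInExtChartAt
    (hF : ContMDiff I J 2 F) {x : S} {z : E}
    (hz : z ∈ (extChartAt I x).target)
    (hFz : F ((extChartAt I x).symm z) ∈ (extChartAt J (F x)).source)
    (X : TangentSpace J (F ((extChartAt I x).symm z))) (v : E) :
    coordMetric g (F x) (mfderiv J 𝓘(ℝ, E') (extChartAt J (F x)) (F ((extChartAt I x).symm z)) X)
        (fderivWithin ℝ (writtenInExtChartAt I J x F) (range I) z v)
        (writtenInExtChartAt I J x F z) =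
      g _ X (mfderiv I J F ((extChartAt I x).symm z)
        (mfderivWithin 𝓘(ℝ, E) I (extChartAt I x).symm (range I) z v)) := by
  rw [fderivWithin_writtenInExtChartAt hF hz hFz]
  exact coordMetric_mfderiv g hFz _ _

variable [FiniteDimensional ℝ E']

theorem dMetric_pullback (hg : IsDifferentiableMetric g) (hF : ContMDiff I J 2 F)
    {g' : ∀ x : S, TangentSpace I x → TangentSpace I x → ℝ}
    (hiso : ∀ x v w, g (F x) (mfderiv I J F x v) (mfderiv I J F x w) = g' x v w) (x : S)
    (u v w : TangentSpace I x) :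
    dMetric g' x u v w =
      dMetric g (F x) (mfderiv I J F x u) (mfderiv I J F x v) (mfderiv I J F x w) +
        g (F x) (sndDerivInCharts I J F x u v) (mfderiv I J F x w) +
        g (F x) (mfderiv I J F x v) (sndDerivInCharts I J F x u w) := by
  have hpull : coordMetric g' x v w =ᶠ[𝓝[range I] (extChartAt I x x)] fun z =>
      coordMetric g (F x) (fderivWithin ℝ (writtenInExtChartAt I J x F) (range I) z v)
        (fderivWithin ℝ (writtenInExtChartAt I J x F) (range I) z w)
        (writtenInExtChartAt I J x F z) := by
    filter_upwards [eventually_mem_target_and_mem_source (J := J) hF.continuous x] with z hz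
    rw [fderivWithin_writtenInExtChartAt hF hz.1 hz.2 v]
    exact ((coordMetric_fderivWithin_writtenInExtChartAt g hF hz.1 hz.2 _ w).trans
      (hiso _ _ _)).symm
  have hderiv := hasFDerivWithinAt_fderivWithin_writtenInExtChartAt_apply hF x
  refine congr($(hpull.fderivWithin_eq_of_mem (mem_range_self _)) u).trans
    ((fderivWithin_coordMetric_writtenInExtChartAt hg hF x (hderiv v).differentiableWithinAt
      (hderiv w).differentiableWithinAt u).trans ?_)
  have hunique := I.uniqueDiffOn _ (mem_range_self (chartAt H x x))
  rw [fderivWithin_writtenInExtChartAt_self hF x v, fderivWithin_writtenInExtChartAt_self hF x w]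
  exact congr(_ + g (F x) ($((hderiv v).fderivWithin hunique) u) _ +
    g (F x) _ ($((hderiv w).fderivWithin hunique) u))

theorem christoffel_pullback (hg : IsDifferentiableMetric g) (hF : ContMDiff I J 2 F)
    {g' : ∀ x : S, TangentSpace I x → TangentSpace I x → ℝ}
    (hiso : ∀ x v w, g (F x) (mfderiv I J F x v) (mfderiv I J F x w) = g' x v w) (x : S)
    (u v w : TangentSpace I x) :
    christoffel g' x u v w =
      christoffel g (F x) (mfderiv I J F x u) (mfderiv I J F x v) (mfderiv I J F x w) +
        g (F x) (sndDerivInCharts I J F x u v) (mfderiv I J F x w) := by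
  unfold christoffel
  rw [dMetric_pullback hg hF hiso, dMetric_pullback hg hF hiso x v u w,
    dMetric_pullback hg hF hiso x w u v, sndDerivInCharts_comm hF x v u,
    sndDerivInCharts_comm hF x w u, sndDerivInCharts_comm hF x w v,
    hg.symm (F x) (mfderiv I J F x v), hg.symm (F x) (mfderiv I J F x u)]
  ring

end Immersion

section RiemannianMetric

theorem isBilinearMap_coe {R V W : Type*} [CommSemiring R] [AddCommMonoid V] [Module R V]
    [AddCommMonoid W] [Module R W] (B : V →ₗ[R] V →ₗ[R] W) :
    IsBilinearMap R fun v w => B v w where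
  add_left := B.map_add₂
  smul_left := B.map_smul₂
  add_right v := (B v).map_add
  smul_right c v := (B v).map_smul c

variable {E : Type*} [NormedAddCommGroup E] [NormedSpace ℝ E]
  {H : Type*} [TopologicalSpace H] {I : ModelWithCorners ℝ E H}
  {P : Type*} [TopologicalSpace P] [ChartedSpace H P]

theorem trivializationAt_tangent_snd [IsManifold I 1 P] {x p : P} (hp : p ∈ (chartAt H x).source)
    (X : TangentSpace I p) :
    (trivializationAt E (TangentSpace I) x (⟨p, X⟩ : TangentBundle I P)).2 =
      mfderiv I 𝓘(ℝ, E) (extChartAt I x) p X := by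
  rw [← TangentBundle.continuousLinearMapAt_trivializationAt hp]
  exact congr($((trivializationAt E (TangentSpace I) x).coe_linearMapAt_of_mem (R := ℝ)
    (by simpa using hp)) X).symm

theorem contMDiffWithinAt_mfderivWithin_extChartAt_symm [IsManifold I 2 P] (x : P) (v : E) :
    ContMDiffWithinAt 𝓘(ℝ, E) (I.prod 𝓘(ℝ, E)) 1
      (fun y => (⟨(extChartAt I x).symm y,
        mfderivWithin 𝓘(ℝ, E) I (extChartAt I x).symm (range I) y v⟩ : TangentBundle I P))
      (range I) (extChartAt I x x) := by
  have : IsManifold I 1 P := .of_le one_le_two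
  rw [contMDiffWithinAt_totalSpace]
  refine ⟨contMDiffWithinAt_extChartAt_symm_range x (mem_extChartAt_target x),
    (contMDiffWithinAt_const (c := v)).congr_of_eventuallyEq_of_mem ?_ (mem_range_self _)⟩
  filter_upwards [extChartAt_target_mem_nhdsWithin x] with y hy
  rw [extChartAt_to_inv, trivializationAt_tangent_snd
    (by rw [← extChartAt_source I]; exact (extChartAt I x).map_target hy)]
  exact congr($(mfderiv_extChartAt_comp_mfderivWithin_extChartAt_symm (I := I) hy) v)

variable [RiemannianBundle (fun x : P => TangentSpace I x)]

theorem isBilinearMap_metricTensor (x : P) : IsBilinearMap ℝ (metricTensor I x) :=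
  isBilinearMap_coe (innerₗ (TangentSpace I x))

theorem isDifferentiableMetric_metricTensor [IsManifold I 2 P]
    [IsContMDiffRiemannianBundle I 1 E (fun x : P => TangentSpace I x)] :
    IsDifferentiableMetric (metricTensor I (S := P)) where
  bilinear := isBilinearMap_metricTensor
  symm _ _ _ := real_inner_comm _ _
  differentiableWithinAt x v w := by
    have h : ContMDiffWithinAt 𝓘(ℝ, E) 𝓘(ℝ, ℝ) 1 (coordMetric (metricTensor I) x v w) (range I)
        (extChartAt I x x) :=
      ContMDiffWithinAt.inner_bundle (E := fun x : P => TangentSpace I x)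
        (contMDiffWithinAt_mfderivWithin_extChartAt_symm x v)
        (contMDiffWithinAt_mfderivWithin_extChartAt_symm x w)
    exact (contMDiffWithinAt_iff_contDiffWithinAt.1 h).differentiableWithinAt one_ne_zero

end RiemannianMetric

section CylinderMetric

variable {n : ℕ} [NeZero n]
  {M : Type*} [TopologicalSpace M] [ChartedSpace (EuclideanHalfSpace n) M]

theorem extChartAt_cylModel_symm (y : M × ℝ) :
    ((extChartAt (cylModel n) y).symm : EuclideanSpace ℝ (Fin n) × ℝ → M × ℝ) =
      Prod.map (extChartAt (𝓡∂ n) y.1).symm id := by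
  rw [extChartAt_prod, extChartAt_model_space_eq_id]
  rfl

theorem range_cylModel : range (cylModel n) = range (𝓡∂ n) ×ˢ (univ : Set ℝ) := by
  rw [ModelWithCorners.range_prod, modelWithCornersSelf_coe, range_id]

theorem fst_mem_target_of_mem_target_cylModel {y : M × ℝ} {Y : EuclideanSpace ℝ (Fin n) × ℝ}
    (hY : Y ∈ (extChartAt (cylModel n) y).target) : Y.1 ∈ (extChartAt (𝓡∂ n) y.1).target := by
  rw [extChartAt_prod, PartialEquiv.prod_target] at hY
  exact hY.1

theorem mfderivWithin_extChartAt_cylModel_symm [IsManifold (𝓡∂ n) 1 M] {y : M × ℝ}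
    {Y : EuclideanSpace ℝ (Fin n) × ℝ} (hY : Y ∈ (extChartAt (cylModel n) y).target)
    (V : EuclideanSpace ℝ (Fin n) × ℝ) :
    (mfderivWithin 𝓘(ℝ, EuclideanSpace ℝ (Fin n) × ℝ) (cylModel n)
        (extChartAt (cylModel n) y).symm (range (cylModel n)) Y V :
          EuclideanSpace ℝ (Fin n) × ℝ) =
      ((mfderivWithin 𝓘(ℝ, EuclideanSpace ℝ (Fin n)) (𝓡∂ n) (extChartAt (𝓡∂ n) y.1).symm
        (range (𝓡∂ n)) Y.1 V.1 : EuclideanSpace ℝ (Fin n)), V.2) := by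
  have hY₁ := fst_mem_target_of_mem_target_cylModel hY
  have hprod := mfderivWithin_prodMap (p := Y) (s := range (𝓡∂ n)) (t := univ) (g := (id : ℝ → ℝ))
    (mdifferentiableWithinAt_extChartAt_symm hY₁)
    (mdifferentiableAt_id (I := 𝓘(ℝ, ℝ))).mdifferentiableWithinAt
    ((𝓡∂ n).uniqueMDiffOn _ (extChartAt_target_subset_range _ hY₁))
    (uniqueMDiffWithinAt_univ 𝓘(ℝ, ℝ))
  rw [mfderivWithin_univ, mfderiv_id] at hprod
  rw [extChartAt_cylModel_symm, range_cylModel, modelWithCornersSelf_prod,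
    ← chartedSpaceSelf_prod]
  exact congr($hprod V)

variable [RiemannianBundle (fun x : M => TangentSpace (𝓡∂ n) x)]

theorem coordMetric_cylMetric [IsManifold (𝓡∂ n) 1 M] {y : M × ℝ}
    {Y : EuclideanSpace ℝ (Fin n) × ℝ} (hY : Y ∈ (extChartAt (cylModel n) y).target)
    (V W : EuclideanSpace ℝ (Fin n) × ℝ) :
    coordMetric cylMetric y V W Y =
      coordMetric (metricTensor (𝓡∂ n)) y.1 V.1 W.1 Y.1 + V.2 * W.2 := by
  have htransport : ∀ p q : M × ℝ, p = q → ∀ v w v' w' : EuclideanSpace ℝ (Fin n) × ℝ,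
      v = v' → w = w' →
        cylMetric p (show TangentSpace (cylModel n) p from v)
          (show TangentSpace (cylModel n) p from w) =
        cylMetric q (show TangentSpace (cylModel n) q from v')
          (show TangentSpace (cylModel n) q from w') := by
    rintro p _ rfl v w _ _ rfl rfl
    rfl
  exact htransport _ ((extChartAt (𝓡∂ n) y.1).symm Y.1, Y.2)
    congr($(extChartAt_cylModel_symm y) Y) _ _ _ _
    (mfderivWithin_extChartAt_cylModel_symm hY V) (mfderivWithin_extChartAt_cylModel_symm hY W)

theorem isBilinearMap_cylMetric (y : M × ℝ) : IsBilinearMap ℝ (cylMetric (n := n) y) :=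
  let π₁ : TangentSpace (cylModel n) y →ₗ[ℝ] TangentSpace (𝓡∂ n) y.1 :=
    LinearMap.fst ℝ (EuclideanSpace ℝ (Fin n)) ℝ
  let π₂ : TangentSpace (cylModel n) y →ₗ[ℝ] ℝ := LinearMap.snd ℝ (EuclideanSpace ℝ (Fin n)) ℝ
  isBilinearMap_coe ((innerₗ (TangentSpace (𝓡∂ n) y.1)).compl₁₂ π₁ π₁ +
    (LinearMap.mul ℝ ℝ).compl₁₂ π₂ π₂)

theorem cylMetric_comm (y : M × ℝ) (v w : TangentSpace (cylModel n) y) :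
    cylMetric y v w = cylMetric y w v := by
  rw [cylMetric, cylMetric, real_inner_comm, mul_comm]

theorem cylMetric_xi_right (y : M × ℝ) (v : TangentSpace (cylModel n) y) :
    cylMetric y v (xi y) = vert y v := by
  have hhoriz : horiz (n := n) y (xi y) = 0 := rfl
  have hvert : vert (n := n) y (xi y) = 1 := rfl
  rw [cylMetric, hhoriz, hvert, inner_zero_right, zero_add, mul_one]

variable [IsManifold (𝓡∂ n) 2 M]
  [IsContMDiffRiemannianBundle (𝓡∂ n) 1 (EuclideanSpace ℝ (Fin n))
    (fun x : M => TangentSpace (𝓡∂ n) x)]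

theorem hasFDerivWithinAt_coordMetric_cylMetric (y : M × ℝ) (V W : EuclideanSpace ℝ (Fin n) × ℝ) :
    HasFDerivWithinAt (coordMetric cylMetric y V W)
      ((fderivWithin ℝ (coordMetric (metricTensor (𝓡∂ n)) y.1 V.1 W.1) (range (𝓡∂ n))
        (extChartAt (𝓡∂ n) y.1 y.1)).comp (ContinuousLinearMap.fst ℝ _ ℝ))
      (range (cylModel n)) (extChartAt (cylModel n) y y) := by
  have : IsManifold (𝓡∂ n) 1 M := .of_le one_le_two
  have hfst : (extChartAt (cylModel n) y y).1 = extChartAt (𝓡∂ n) y.1 y.1 := by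
    rw [extChartAt_prod]
    rfl
  have hbase := ((isDifferentiableMetric_metricTensor (I := 𝓡∂ n)).differentiableWithinAt
    y.1 V.1 W.1).hasFDerivWithinAt
  rw [← hfst] at hbase ⊢
  refine ((hbase.comp (extChartAt (cylModel n) y y) (s := range (cylModel n))
    (ContinuousLinearMap.fst ℝ (EuclideanSpace ℝ (Fin n)) ℝ).hasFDerivWithinAt
    (fun z hz => (range_cylModel (n := n) ▸ hz).1)).add_const
      (V.2 * W.2)).congr_of_eventuallyEq ?_ (coordMetric_cylMetric (mem_extChartAt_target y) V W)
  filter_upwards [extChartAt_target_mem_nhdsWithin y] with Y hY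
  exact coordMetric_cylMetric hY V W

theorem isDifferentiableMetric_cylMetric :
    IsDifferentiableMetric (cylMetric (n := n) (M := M)) where
  bilinear := isBilinearMap_cylMetric
  symm := cylMetric_comm
  differentiableWithinAt y V W :=
    (hasFDerivWithinAt_coordMetric_cylMetric y V W).differentiableWithinAt

theorem dMetric_cylMetric (y : M × ℝ) (U V W : EuclideanSpace ℝ (Fin n) × ℝ) :
    dMetric cylMetric y U V W = dMetric (metricTensor (𝓡∂ n)) y.1 U.1 V.1 W.1 :=
  congr($((hasFDerivWithinAt_coordMetric_cylMetric y V W).fderivWithin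
    ((cylModel n).uniqueDiffOn _ (mem_range_self _))) U)

theorem christoffel_cylMetric (y : M × ℝ) (U V W : EuclideanSpace ℝ (Fin n) × ℝ) :
    christoffel cylMetric y U V W = christoffel (metricTensor (𝓡∂ n)) y.1 U.1 V.1 W.1 := by
  simp only [christoffel, dMetric_cylMetric]

theorem christoffel_cylMetric_xi_right (y : M × ℝ) (U V : TangentSpace (cylModel n) y) :
    christoffel cylMetric y U V (xi y) = 0 :=
  (christoffel_cylMetric y U V (xi y)).trans
    (christoffel_zero_right isBilinearMap_metricTensor y.1 _ _)

theorem christoffel_cylMetric_neg_xi_middle (y : M × ℝ) (U V : TangentSpace (cylModel n) y) :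
    christoffel cylMetric y U (-xi y) V = 0 := by
  refine (christoffel_cylMetric y U (-xi y) V).trans ?_
  have hfst : (-xi y : EuclideanSpace ℝ (Fin n) × ℝ).1 = 0 := neg_zero
  rw [hfst]
  exact christoffel_zero_middle isBilinearMap_metricTensor y.1 _ _

end CylinderMetric

section Gradient

variable {E : Type*} [NormedAddCommGroup E] [NormedSpace ℝ E] [FiniteDimensional ℝ E]
  {H : Type*} [TopologicalSpace H] {I : ModelWithCorners ℝ E H}
  {S : Type*} [TopologicalSpace S] [ChartedSpace H S]
  [RiemannianBundle (fun x : S => TangentSpace I x)]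

theorem inner_grad (u : S → ℝ) (x : S) (v : TangentSpace I x) :
    inner ℝ (grad I u x) v = differential I u x v := by
  let du : TangentSpace I x →ₗ[ℝ] ℝ := (mfderiv I 𝓘(ℝ, ℝ) u x).toLinearMap
  let b := stdOrthonormalBasis ℝ (TangentSpace I x)
  change inner ℝ (∑ i, du (b i) • b i) v = du v
  conv_rhs => rw [← b.sum_repr' v, map_sum]
  rw [sum_inner]
  exact Finset.sum_congr rfl fun i _ => by
    rw [real_inner_smul_left, map_smul, smul_eq_mul, mul_comm]

end Gradient

section Height

variable {n : ℕ} [NeZero n]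
  {M : Type*} [TopologicalSpace M] [ChartedSpace (EuclideanHalfSpace n) M]

theorem coordField_self [IsManifold (𝓡∂ n) 1 M] {S : Type*} {F : S → M × ℝ}
    (X : ∀ x : S, TangentSpace (cylModel n) (F x)) (x : S) :
    coordField F X x x = X x :=
  congr($(mfderiv_extChartAt_self (I := cylModel n) (x := F x)) (X x))

variable {S : Type*} [TopologicalSpace S] [ChartedSpace (EuclideanHalfSpace n) S] {F : S → M × ℝ}

/-- The height function of a map into the cylinder `M × ℝ`. -/
def height {S M : Type*} (F : S → M × ℝ) (x : S) : ℝ := (F x).2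

theorem differential_height {x : S} (hF : MDifferentiableAt (𝓡∂ n) (cylModel n) F x)
    (v : TangentSpace (𝓡∂ n) x) :
    differential (𝓡∂ n) (height F) x v = vert (F x) (mfderiv (𝓡∂ n) (cylModel n) F x v) := by
  have hcomp := mfderiv_comp x (mdifferentiableAt_snd (I := 𝓡∂ n) (I' := 𝓘(ℝ, ℝ)) (x := F x)) hF
  rw [mfderiv_snd] at hcomp
  exact congr($hcomp v)

theorem mfderiv_fst_apply {x : S} (hF : MDifferentiableAt (𝓡∂ n) (cylModel n) F x)
    (v : TangentSpace (𝓡∂ n) x) :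
    mfderiv (𝓡∂ n) (𝓡∂ n) (fun p => (F p).1) x v =
      horiz (F x) (mfderiv (𝓡∂ n) (cylModel n) F x v) := by
  have hcomp := mfderiv_comp x (mdifferentiableAt_fst (I := 𝓡∂ n) (I' := 𝓘(ℝ, ℝ)) (x := F x)) hF
  rw [mfderiv_fst] at hcomp
  exact congr($hcomp v)

theorem fderivWithin_fderivWithin_height (hF : ContMDiff (𝓡∂ n) (cylModel n) 2 F) (x : S)
    (v w : EuclideanSpace ℝ (Fin n)) :
    (fderivWithin ℝ (fderivWithin ℝ (height F ∘ (extChartAt (𝓡∂ n) x).symm) (range (𝓡∂ n)))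
        (range (𝓡∂ n)) (extChartAt (𝓡∂ n) x x) :
          EuclideanSpace ℝ (Fin n) →L[ℝ] EuclideanSpace ℝ (Fin n) →L[ℝ] ℝ) v w =
      vert (F x) (sndDerivInCharts (𝓡∂ n) (cylModel n) F x v w) := by
  have hheight : height F ∘ (extChartAt (𝓡∂ n) x).symm =
      ContinuousLinearMap.snd ℝ (EuclideanSpace ℝ (Fin n)) ℝ ∘
        writtenInExtChartAt (𝓡∂ n) (cylModel n) x F := by
    rw [writtenInExtChartAt, extChartAt_prod, extChartAt_model_space_eq_id]
    rfl
  have hx : extChartAt (𝓡∂ n) x x ∈ range (𝓡∂ n) := mem_range_self _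
  rw [hheight, ← iteratedFDerivWithin_two_apply' _ (𝓡∂ n).uniqueDiffOn hx,
    ContinuousLinearMap.iteratedFDerivWithin_comp_left
      (f := writtenInExtChartAt (𝓡∂ n) (cylModel n) x F) _ (contMDiffAt_iff.1 (hF x)).2
      (𝓡∂ n).uniqueDiffOn hx le_rfl]
  exact congrArg Prod.snd (iteratedFDerivWithin_two_apply' _ (𝓡∂ n).uniqueDiffOn hx v w)

variable [IsManifold (𝓡∂ n) ∞ M]
  [RiemannianBundle (fun x : M => TangentSpace (𝓡∂ n) x)]
  [RiemannianBundle (fun x : S => TangentSpace (𝓡∂ n) x)]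
  {N : ∀ x : S, TangentSpace (cylModel n) (F x)}

theorem IsTwoSidedHypersurface.mdifferentiableAt (hF : IsTwoSidedHypersurface F N) (x : S) :
    MDifferentiableAt (𝓡∂ n) (cylModel n) F x :=
  hF.smooth.mdifferentiableAt (by simp)

theorem IsTwoSidedHypersurface.contMDiff_two (hF : IsTwoSidedHypersurface F N) :
    ContMDiff (𝓡∂ n) (cylModel n) 2 F :=
  hF.smooth.of_le (by norm_cast)

theorem exists_mfderiv_add_smul_normal (hF : IsTwoSidedHypersurface F N) (x : S)
    (w : TangentSpace (cylModel n) (F x)) :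
    ∃ (v : TangentSpace (𝓡∂ n) x) (t : ℝ),
      mfderiv (𝓡∂ n) (cylModel n) F x v + t • N x = w := by
  let L : TangentSpace (𝓡∂ n) x × ℝ →ₗ[ℝ] TangentSpace (cylModel n) (F x) :=
    (mfderiv (𝓡∂ n) (cylModel n) F x).toLinearMap.coprod (LinearMap.toSpanSingleton ℝ _ (N x))
  have hg := isBilinearMap_cylMetric (n := n) (F x)
  have hinj : Function.Injective L := by
    refine (injective_iff_map_eq_zero _).2 fun ⟨v, t⟩ hvt => ?_
    replace hvt : mfderiv (𝓡∂ n) (cylModel n) F x v + t • N x = 0 := hvt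
    have ht : t = 0 := by
      have h : cylMetric (F x) (N x) 0 = 0 := (hg.toLinearMap (N x)).map_zero
      rwa [← hvt, hg.add_right, hg.smul_right, hF.normal, hF.unit, zero_add, smul_eq_mul,
        mul_one] at h
    have hv : mfderiv (𝓡∂ n) (cylModel n) F x v = 0 := by rwa [ht, zero_smul, add_zero] at hvt
    have hvv : inner ℝ v v = 0 :=
      (hF.isometric x v v).symm.trans (hv ▸ (hg.toLinearMap _).map_zero)
    exact Prod.ext (inner_self_eq_zero.1 hvv) ht
  have : FiniteDimensional ℝ (TangentSpace (cylModel n) (F x)) :=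
    inferInstanceAs (FiniteDimensional ℝ (EuclideanSpace ℝ (Fin n) × ℝ))
  have hrank : Module.finrank ℝ (TangentSpace (𝓡∂ n) x × ℝ) =
      Module.finrank ℝ (TangentSpace (cylModel n) (F x)) :=
    rfl
  obtain ⟨⟨v, t⟩, hvt⟩ :=
    (LinearMap.injective_iff_surjective_of_finrank_eq_finrank hrank).1 hinj w
  exact ⟨v, t, hvt⟩

theorem mfderiv_grad_height (hF : IsTwoSidedHypersurface F N) (x : S) :
    mfderiv (𝓡∂ n) (cylModel n) F x (grad (𝓡∂ n) (height F) x) =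
      xi (F x) - angle F N x • N x := by
  have hg := isBilinearMap_cylMetric (n := n) (F x)
  obtain ⟨k, t, hk⟩ := exists_mfderiv_add_smul_normal hF x (xi (F x))
  have ht : angle F N x = t := by
    rw [angle, cylMetric_comm, ← hk, hg.add_right, hg.smul_right, hF.normal, hF.unit, zero_add,
      smul_eq_mul, mul_one]
  have hgrad : grad (𝓡∂ n) (height F) x = k := by
    refine ext_inner_right ℝ fun v => ?_
    rw [inner_grad, differential_height (hF.mdifferentiableAt x), ← cylMetric_xi_right, ← hk,
      hg.add_right, hg.smul_right, cylMetric_comm _ _ (N x), hF.normal, cylMetric_comm,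
      hF.isometric, smul_zero, add_zero]
  rw [hgrad, ht, ← hk, add_sub_cancel_right]

theorem inner_grad_grad_height (hF : IsTwoSidedHypersurface F N) {ψ : M × ℝ → ℝ} {x : S}
    (hψ : MDifferentiableAt (cylModel n) 𝓘(ℝ, ℝ) ψ (F x)) :
    inner ℝ (grad (𝓡∂ n) (ψ ∘ F) x) (grad (𝓡∂ n) (height F) x) =
      differential (cylModel n) ψ (F x) (xi (F x)) -
        angle F N x * differential (cylModel n) ψ (F x) (N x) := by
  let dψ : TangentSpace (cylModel n) (F x) →ₗ[ℝ] ℝ :=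
    (mfderiv (cylModel n) 𝓘(ℝ, ℝ) ψ (F x)).toLinearMap
  have hcomp : differential (𝓡∂ n) (ψ ∘ F) x (grad (𝓡∂ n) (height F) x) =
      dψ (mfderiv (𝓡∂ n) (cylModel n) F x (grad (𝓡∂ n) (height F) x)) :=
    congr($(mfderiv_comp x hψ (hF.mdifferentiableAt x)) _)
  rw [inner_grad, hcomp, mfderiv_grad_height hF, map_sub, map_smul]
  rfl

theorem mdifferentiableAt_coordField (hF : IsTwoSidedHypersurface F N) (x : S) :
    MDifferentiableAt (𝓡∂ n) 𝓘(ℝ, EuclideanSpace ℝ (Fin n) × ℝ) (coordField F N x) x := by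
  have htriv := (contMDiffAt_totalSpace.1 (hF.smooth_normal x)).2
  refine (htriv.mdifferentiableAt (by simp)).congr_of_eventuallyEq ?_
  filter_upwards [hF.smooth.continuous.continuousAt.preimage_mem_nhds
    (chart_source_mem_nhds (ModelProd (EuclideanHalfSpace n) ℝ) (F x))] with z hz
  exact (trivializationAt_tangent_snd hz (N z)).symm

variable [IsManifold (𝓡∂ n) ∞ S]
  [IsContMDiffRiemannianBundle (𝓡∂ n) 1 (EuclideanSpace ℝ (Fin n))
    (fun x : M => TangentSpace (𝓡∂ n) x)]

theorem covDerivInner_normal (hF : IsTwoSidedHypersurface F N) (x : S)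
    (v w : TangentSpace (𝓡∂ n) x) :
    covDerivInner F N x v (mfderiv (𝓡∂ n) (cylModel n) F x w) =
      -(cylMetric (F x) (N x) (sndDerivInCharts (𝓡∂ n) (cylModel n) F x v w) +
        christoffel cylMetric (F x) (mfderiv (𝓡∂ n) (cylModel n) F x v)
          (mfderiv (𝓡∂ n) (cylModel n) F x w) (N x)) := by
  have hg := isDifferentiableMetric_cylMetric (n := n) (M := M)
  have hF₂ := hF.contMDiff_two
  have hN := mdifferentiableAt_coordField hF x
  have hderiv := hasFDerivWithinAt_fderivWithin_writtenInExtChartAt_apply hF₂ x w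
  have hx : extChartAt (𝓡∂ n) x x ∈ range (𝓡∂ n) := mem_range_self _
  have hnormal : (fun z => coordMetric cylMetric (F x)
      (writtenInExtChartAt (𝓡∂ n) 𝓘(ℝ, EuclideanSpace ℝ (Fin n) × ℝ) x (coordField F N x) z)
      (fderivWithin ℝ (writtenInExtChartAt (𝓡∂ n) (cylModel n) x F) (range (𝓡∂ n)) z w)
      (writtenInExtChartAt (𝓡∂ n) (cylModel n) x F z))
      =ᶠ[𝓝[range (𝓡∂ n)] (extChartAt (𝓡∂ n) x x)] fun _ => 0 := by
    filter_upwards [eventually_mem_target_and_mem_source (J := cylModel n) hF₂.continuous x]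
      with z hz
    exact (coordMetric_fderivWithin_writtenInExtChartAt cylMetric hF₂ hz.1 hz.2 _ w).trans
      (hF.normal _ _)
  have hproduct := fderivWithin_coordMetric_writtenInExtChartAt hg hF₂ x
    hN.differentiableWithinAt_writtenInExtChartAt hderiv.differentiableWithinAt v
  have hN₀ : writtenInExtChartAt (𝓡∂ n) 𝓘(ℝ, EuclideanSpace ℝ (Fin n) × ℝ) x (coordField F N x)
      (extChartAt (𝓡∂ n) x x) = N x :=
    (congrArg (coordField F N x) (extChartAt_to_inv x)).trans (coordField_self N x)
  rw [hnormal.fderivWithin_eq_of_mem hx, fderivWithin_fun_const, hN₀,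
    hderiv.fderivWithin ((𝓡∂ n).uniqueDiffOn _ hx), fderivWithin_writtenInExtChartAt_self hF₂,
    ← hN.mfderiv] at hproduct
  replace hproduct : 0 = dMetric cylMetric (F x) (mfderiv (𝓡∂ n) (cylModel n) F x v) (N x)
      (mfderiv (𝓡∂ n) (cylModel n) F x w) +
      cylMetric (F x) (mfderiv (𝓡∂ n) 𝓘(ℝ, EuclideanSpace ℝ (Fin n) × ℝ) (coordField F N x) x v)
        (mfderiv (𝓡∂ n) (cylModel n) F x w) +
      cylMetric (F x) (N x) (sndDerivInCharts (𝓡∂ n) (cylModel n) F x v w) := hproduct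
  have hchristoffel := hg.christoffel_add_christoffel (F x) (mfderiv (𝓡∂ n) (cylModel n) F x v)
    (N x) (mfderiv (𝓡∂ n) (cylModel n) F x w)
  unfold covDerivInner
  linarith

theorem hessian_height (hF : IsTwoSidedHypersurface F N) (x : S) (v w : TangentSpace (𝓡∂ n) x) :
    hessian (𝓡∂ n) (height F) x v w =
      -angle F N x * covDerivInner F N x v (mfderiv (𝓡∂ n) (cylModel n) F x w) := by
  have hg := isDifferentiableMetric_cylMetric (n := n) (M := M)
  let D := mfderiv (𝓡∂ n) (cylModel n) F x
  let A := sndDerivInCharts (𝓡∂ n) (cylModel n) F x v w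
  have hinner : ∀ q : TangentSpace (cylModel n) (F x),
      cylMetric (F x) q (xi (F x) - angle F N x • N x) =
        vert (F x) q - angle F N x * cylMetric (F x) (N x) q := fun q => by
    rw [← cylMetric_xi_right, cylMetric_comm _ (N x)]
    exact (((hg.bilinear (F x)).toLinearMap q).map_sub _ _).trans
      congr(_ - $(((hg.bilinear (F x)).toLinearMap q).map_smul _ _))
  have hpullback : christoffel (metricTensor (𝓡∂ n)) x v w (grad (𝓡∂ n) (height F) x) =
      vert (F x) A - angle F N x *
        (cylMetric (F x) (N x) A + christoffel cylMetric (F x) (D v) (D w) (N x)) := by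
    refine (christoffel_pullback (g' := metricTensor (𝓡∂ n)) hg hF.contMDiff_two hF.isometric
      x v w _).trans ?_
    rw [mfderiv_grad_height hF, hinner]
    have hsub := hg.christoffel_sub_smul (F x) (D v) (D w) (xi (F x)) (N x) (angle F N x)
    have hxi := christoffel_cylMetric_xi_right (F x) (D v) (D w)
    exact congr($hsub + _).trans (by rw [hxi]; ring)
  rw [hessian, hpullback, covDerivInner_normal hF]
  exact congr($(fderivWithin_fderivWithin_height hF.contMDiff_two x v w) - _).trans (by ring)

end Height

section Weight

variable {n : ℕ} [NeZero n]
  {M : Type*} [TopologicalSpace M] [ChartedSpace (EuclideanHalfSpace n) M]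
  {h : M → ℝ} {v : ℝ → ℝ}

theorem mdifferentiableAt_productWeight {y : M × ℝ} (hh : MDifferentiableAt (𝓡∂ n) 𝓘(ℝ, ℝ) h y.1)
    (hv : DifferentiableAt ℝ v y.2) :
    MDifferentiableAt (cylModel n) 𝓘(ℝ, ℝ) (productWeight h v) y :=
  (hh.comp y mdifferentiableAt_fst).add (hv.mdifferentiableAt.comp y mdifferentiableAt_snd)

theorem differential_productWeight_xi {y : M × ℝ} (hh : MDifferentiableAt (𝓡∂ n) 𝓘(ℝ, ℝ) h y.1)
    (hv : DifferentiableAt ℝ v y.2) :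
    differential (cylModel n) (productWeight h v) y (xi y) = deriv v y.2 := by
  have hline : MDifferentiableAt 𝓘(ℝ, ℝ) (cylModel n) (fun t : ℝ => (y.1, t)) y.2 :=
    mdifferentiableAt_const.prodMk mdifferentiableAt_id
  have hcomp := mfderiv_comp y.2 (g := productWeight h v) (f := fun t : ℝ => (y.1, t))
    (mdifferentiableAt_productWeight hh hv) hline
  rw [mfderiv_prod_right] at hcomp
  have hderiv : HasDerivAt (productWeight h v ∘ fun t : ℝ => (y.1, t)) (deriv v y.2) y.2 :=
    hv.hasDerivAt.const_add (h y.1)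
  exact congr($hcomp (1 : ℝ)).symm.trans
    (congr($(hderiv.hasFDerivAt.hasMFDerivAt.mfderiv) (1 : ℝ)).trans (one_smul ℝ (deriv v y.2)))

variable [IsManifold (𝓡∂ n) ∞ M]

theorem coordField_sliceNormal {s : ℝ} {p z : M} (hz : z ∈ (extChartAt (𝓡∂ n) p).source) :
    coordField (slice s) (sliceNormal (n := n) s) p z = (0, -1) := by
  have hsource : slice s z ∈ (extChartAt (cylModel n) (slice s p)).source := by
    rw [extChartAt_source] at hz ⊢
    exact ⟨hz, mem_univ _⟩
  have hsymm : (mfderivWithin 𝓘(ℝ, EuclideanSpace ℝ (Fin n) × ℝ) (cylModel n)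
      (extChartAt (cylModel n) (slice s p)).symm (range (cylModel n))
        (extChartAt (cylModel n) (slice s p) (slice s z)) (0, -1) :
          EuclideanSpace ℝ (Fin n) × ℝ) = (0, -1) :=
    (mfderivWithin_extChartAt_cylModel_symm ((extChartAt _ _).map_source hsource) (0, -1)).trans
      (Prod.ext (map_zero (mfderivWithin 𝓘(ℝ, EuclideanSpace ℝ (Fin n)) (𝓡∂ n)
        (extChartAt (𝓡∂ n) p).symm (range (𝓡∂ n)) _)) rfl)
  have hnormal : (sliceNormal (n := n) s z : EuclideanSpace ℝ (Fin n) × ℝ) = (0, -1) :=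
    Prod.ext neg_zero rfl
  have hinverse := mfderiv_extChartAt_comp_mfderivWithin_extChartAt_symm' hsource
  exact (congrArg (mfderiv (cylModel n) 𝓘(ℝ, EuclideanSpace ℝ (Fin n) × ℝ)
    (extChartAt (cylModel n) (slice s p)) (slice s z)) (hnormal.trans hsymm.symm)).trans
      congr($hinverse ((0, -1) : EuclideanSpace ℝ (Fin n) × ℝ))

variable [RiemannianBundle (fun x : M => TangentSpace (𝓡∂ n) x)]
  [IsContMDiffRiemannianBundle (𝓡∂ n) 1 (EuclideanSpace ℝ (Fin n))
    (fun x : M => TangentSpace (𝓡∂ n) x)]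

theorem covDerivInner_sliceNormal (s : ℝ) (p : M) (u : TangentSpace (𝓡∂ n) p)
    (w : TangentSpace (cylModel n) (slice s p)) :
    covDerivInner (slice s) (sliceNormal (n := n) s) p u w = 0 := by
  have hconst : coordField (slice s) (sliceNormal (n := n) s) p =ᶠ[𝓝 p] fun _ => (0, -1) :=
    mem_of_superset (extChartAt_source_mem_nhds (I := 𝓡∂ n) p) fun _ => coordField_sliceNormal
  have hderiv : mfderiv (𝓡∂ n) 𝓘(ℝ, EuclideanSpace ℝ (Fin n) × ℝ)
      (coordField (slice s) (sliceNormal (n := n) s) p) p = 0 :=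
    hconst.mfderiv_eq.trans mfderiv_const
  rw [covDerivInner, sliceNormal, christoffel_cylMetric_neg_xi_middle, add_zero]
  exact congr(cylMetric (slice s p) ($hderiv u) w).trans
    ((isBilinearMap_cylMetric (slice s p)).toLinearMap.map_zero₂ w)

theorem weightedMeanCurvature_slice (hh : MDifferentiable (𝓡∂ n) 𝓘(ℝ, ℝ) h)
    {s : ℝ} (hv : DifferentiableAt ℝ v s) (p : M) :
    weightedMeanCurvature (productWeight h v) (slice s) (sliceNormal (n := n) s) p =
      deriv v s := by
  have hnormal : differential (cylModel n) (productWeight h v) (slice s p) (sliceNormal s p) =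
      -deriv v s :=
    (map_neg (mfderiv (cylModel n) 𝓘(ℝ, ℝ) (productWeight h v) (slice s p)) _).trans
      congr(-$(differential_productWeight_xi (y := slice s p) (hh p) hv))
  simp only [weightedMeanCurvature, weightedDiv, metricTrace, covDerivInner_sliceNormal, hnormal,
    Finset.sum_const_zero, zero_add, neg_neg]

variable {S : Type*} [TopologicalSpace S] [ChartedSpace (EuclideanHalfSpace n) S]
  [IsManifold (𝓡∂ n) ∞ S] [RiemannianBundle (fun x : S => TangentSpace (𝓡∂ n) x)]
  {F : S → M × ℝ} {N : ∀ x : S, TangentSpace (cylModel n) (F x)}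

theorem metricTrace_hessian_height (hF : IsTwoSidedHypersurface F N) (x : S) :
    metricTrace (𝓡∂ n) x (hessian (𝓡∂ n) (height F) x) =
      -angle F N x * metricTrace (𝓡∂ n) x
        (fun v w => covDerivInner F N x v (mfderiv (𝓡∂ n) (cylModel n) F x w)) := by
  simp only [metricTrace, Finset.mul_sum, hessian_height hF]

theorem driftedLaplacian_height (hF : IsTwoSidedHypersurface F N)
    (hh : MDifferentiable (𝓡∂ n) 𝓘(ℝ, ℝ) h) (hv : Differentiable ℝ v) (x : S) :
    driftedLaplacian (𝓡∂ n) (productWeight h v ∘ F) (height F) x =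
      deriv v (F x).2 + angle F N x * weightedMeanCurvature (productWeight h v) F N x := by
  rw [driftedLaplacian, metricTrace_hessian_height hF, inner_grad_grad_height hF
    (mdifferentiableAt_productWeight (hh _) (hv _)), differential_productWeight_xi (hh _) (hv _),
    weightedMeanCurvature, weightedDiv]
  ring

end Weight

section FreeBoundary

variable {m n : ℕ} [NeZero m] [NeZero n]
  {S : Type*} [TopologicalSpace S] [ChartedSpace (EuclideanHalfSpace m) S]
  {M : Type*} [TopologicalSpace M] [ChartedSpace (EuclideanHalfSpace n) M]

/-- The transverse component of tangent vectors at `x` as a linear form. -/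
noncomputable def transverseForm (x : M) : TangentSpace (𝓡∂ n) x →ₗ[ℝ] ℝ :=
  (EuclideanSpace.proj (0 : Fin n) : EuclideanSpace ℝ (Fin n) →L[ℝ] ℝ).toLinearMap

theorem extChartAt_zero_eq_zero_of_mem_boundary {x : M} (hx : x ∈ (𝓡∂ n).boundary M) :
    extChartAt (𝓡∂ n) x x 0 = 0 := by
  have hfrontier : extChartAt (𝓡∂ n) x x ∈ frontier (range (𝓡∂ n)) := hx
  rw [frontier_range_modelWithCornersEuclideanHalfSpace] at hfrontier
  exact hfrontier.symm

theorem extChartAt_zero_nonneg (x y : M) : 0 ≤ extChartAt (𝓡∂ n) x y 0 := by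
  have hrange : extChartAt (𝓡∂ n) x y ∈ range (𝓡∂ n) := mem_range_self _
  rwa [range_modelWithCornersEuclideanHalfSpace] at hrange

/- In charts, the zeroth component of `f` is nonnegative and vanishes at `x`, so it has a minimum
at `x` along the boundary line in the direction `w`. -/
theorem transverse_mfderiv_eq_zero {f : S → M} {x : S} (hf : MDifferentiableAt (𝓡∂ m) (𝓡∂ n) f x)
    (hx : x ∈ (𝓡∂ m).boundary S) (hfx : f x ∈ (𝓡∂ n).boundary M)
    {w : TangentSpace (𝓡∂ m) x} (hw : transverse x w = 0) :
    transverse (f x) (mfderiv (𝓡∂ m) (𝓡∂ n) f x w) = 0 := by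
  let e := extChartAt (𝓡∂ m) x x
  let w' : EuclideanSpace ℝ (Fin m) := w
  let φ := writtenInExtChartAt (𝓡∂ m) (𝓡∂ n) x f
  have hline : ∀ t : ℝ, e + t • w' ∈ range (𝓡∂ m) := fun t => by
    rw [range_modelWithCornersEuclideanHalfSpace]
    refine (le_of_eq ?_ : 0 ≤ e 0 + t * w' 0)
    rw [extChartAt_zero_eq_zero_of_mem_boundary hx, show w' 0 = 0 from hw, mul_zero, add_zero]
  have hderiv_line : HasDerivAt (fun t : ℝ => e + t • w') w' 0 := by
    have h := ((hasDerivAt_id (0 : ℝ)).smul_const w').const_add e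
    rwa [one_smul] at h
  have hφ : HasFDerivWithinAt φ (fderivWithin ℝ φ (range (𝓡∂ m)) e) (range (𝓡∂ m))
      (e + (0 : ℝ) • w') := by
    rw [zero_smul, add_zero]
    exact hf.differentiableWithinAt_writtenInExtChartAt.hasFDerivWithinAt
  have hderiv : HasDerivAt (φ ∘ fun t : ℝ => e + t • w') (fderivWithin ℝ φ (range (𝓡∂ m)) e w') 0 :=
    hasDerivWithinAt_univ.1 (hφ.comp_hasDerivWithinAt 0 hderiv_line.hasDerivWithinAt
      fun t _ => hline t)
  have hderiv_zero : HasDerivAt (fun t : ℝ => φ (e + t • w') 0)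
      (fderivWithin ℝ φ (range (𝓡∂ m)) e w' 0) 0 :=
    (EuclideanSpace.proj (0 : Fin n) : EuclideanSpace ℝ (Fin n) →L[ℝ] ℝ).hasFDerivAt.comp_hasDerivAt
      0 hderiv
  have hφ₀ : φ (e + (0 : ℝ) • w') 0 = 0 := by
    rw [zero_smul, add_zero]
    exact congr(extChartAt (𝓡∂ n) (f x) (f $(extChartAt_to_inv x)) 0).trans
      (extChartAt_zero_eq_zero_of_mem_boundary hfx)
  have hmin : IsLocalMin (fun t : ℝ => φ (e + t • w') 0) 0 :=
    Eventually.of_forall fun t => hφ₀.trans_le (extChartAt_zero_nonneg _ _)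
  exact congr(transverse (f x) ($(hf.mfderiv) w)).trans (hmin.hasDerivAt_eq_zero hderiv_zero)

end FreeBoundary

section Constant

variable {E : Type*} [NormedAddCommGroup E] [NormedSpace ℝ E]
  {H : Type*} [TopologicalSpace H] {I : ModelWithCorners ℝ E H}
  {S : Type*} [TopologicalSpace S] [ChartedSpace H S]

theorem differential_const (c : ℝ) (x : S) (w : TangentSpace I x) :
    differential I (fun _ : S => c) x w = 0 :=
  congr($(mfderiv_const (I := I) (I' := 𝓘(ℝ, ℝ)) (c := c) (x := x)) w)

variable [FiniteDimensional ℝ E] [RiemannianBundle (fun x : S => TangentSpace I x)]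

theorem grad_const (c : ℝ) (x : S) : grad I (fun _ : S => c) x = 0 := by
  simp only [grad, differential_const, zero_smul, Finset.sum_const_zero]

theorem hessian_const (c : ℝ) (x : S) (v w : TangentSpace I x) :
    hessian I (fun _ : S => c) x v w = 0 := by
  have hsnd : fderivWithin ℝ
      (fderivWithin ℝ ((fun _ : S => c) ∘ (extChartAt I x).symm) (range I)) (range I)
        (extChartAt I x x) = 0 := by
    rw [show (fun _ : S => c) ∘ (extChartAt I x).symm = fun _ => c from rfl,
      fderivWithin_fun_const]
    exact fderivWithin_const_apply (0 : E →L[ℝ] ℝ)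
  have hchristoffel : christoffel (metricTensor I) x v w (grad I (fun _ : S => c) x) = 0 :=
    (congrArg (christoffel (metricTensor I) x v w) (grad_const c x)).trans
      (christoffel_zero_right (g := metricTensor I) isBilinearMap_metricTensor x v w)
  rw [hessian, hsnd, hchristoffel, sub_zero]
  rfl

theorem driftedLaplacian_const (ψ : S → ℝ) (c : ℝ) (x : S) :
    driftedLaplacian I ψ (fun _ => c) x = 0 := by
  simp only [driftedLaplacian, metricTrace, hessian_const, grad_const, inner_zero_right,
    Finset.sum_const_zero, add_zero]

end Constant

section Rigidity

theorem neg_le_mul_of_abs_le_one {θ H lam : ℝ} (hθ : |θ| ≤ 1) (hlam : 0 ≤ lam)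
    (hH : |H| ≤ lam ∨ θ ≤ 0 ∧ H ≤ lam) : -lam ≤ θ * H := by
  rcases hH with hH | ⟨hθ₀, hH⟩
  · refine neg_le_of_abs_le ?_
    rw [abs_mul, ← one_mul lam]
    exact mul_le_mul hθ hH (abs_nonneg H) zero_le_one
  · calc -lam = -1 * lam := (neg_one_mul lam).symm
      _ ≤ θ * lam := mul_le_mul_of_nonneg_right (neg_le_of_abs_le hθ) hlam
      _ ≤ θ * H := mul_le_mul_of_nonpos_left hH hθ₀

theorem range_subset_range_slice {S M : Type*} {F : S → M × ℝ} {c : ℝ}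
    (hc : ∀ x, height F x = c) : range F ⊆ range (slice (M := M) c) := by
  rintro _ ⟨x, rfl⟩
  exact ⟨(F x).1, Prod.ext rfl (hc x).symm⟩

theorem range_eq_range_slice {S M : Type*} {F : S → M × ℝ} {c : ℝ}
    (hc : ∀ x, height F x = c) (hsurj : Function.Surjective fun x => (F x).1) :
    range F = range (slice (M := M) c) := by
  refine (range_subset_range_slice hc).antisymm ?_
  rintro _ ⟨p, rfl⟩
  obtain ⟨x, hx⟩ := hsurj p
  exact ⟨x, Prod.ext hx (hc x)⟩

variable {n : ℕ} [NeZero n]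
  {M : Type*} [TopologicalSpace M] [ChartedSpace (EuclideanHalfSpace n) M] [IsManifold (𝓡∂ n) ∞ M]
  [RiemannianBundle (fun x : M => TangentSpace (𝓡∂ n) x)]
  {S : Type*} [TopologicalSpace S] [ChartedSpace (EuclideanHalfSpace n) S]
  [RiemannianBundle (fun x : S => TangentSpace (𝓡∂ n) x)]
  {F : S → M × ℝ} {N : ∀ x : S, TangentSpace (cylModel n) (F x)}

theorem abs_angle_le_one (hF : IsTwoSidedHypersurface F N) (x : S) : |angle F N x| ≤ 1 := by
  rw [abs_le_one_iff_mul_self_le_one, angle, cylMetric_comm, cylMetric_xi_right]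
  exact (le_add_of_nonneg_left real_inner_self_nonneg).trans_eq (hF.unit x)

/- Otherwise the transverse component of `dF` would vanish on `ker τ` and on `∇η`, where `τ` is the
transverse component on `S`, hence on all of `T_x S`; as it also vanishes on `N`, it would vanish
identically. -/
theorem transverse_grad_height_eq_zero (hF : IsTwoSidedHypersurface F N) {x : S}
    (hx : x ∈ (𝓡∂ n).boundary S) (hFx : (F x).1 ∈ (𝓡∂ n).boundary M)
    (hN : transverse (F x).1 (horiz (F x) (N x)) = 0) :
    transverse x (grad (𝓡∂ n) (height F) x) = 0 := by
  let D := mfderiv (𝓡∂ n) (cylModel n) F x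
  let τ := transverseForm (n := n) x
  let T : TangentSpace (cylModel n) (F x) →ₗ[ℝ] ℝ :=
    transverseForm (F x).1 ∘ₗ LinearMap.fst ℝ (EuclideanSpace ℝ (Fin n)) ℝ
  let k : TangentSpace (𝓡∂ n) x := grad (𝓡∂ n) (height F) x
  have hTN : T (N x) = 0 := hN
  have hTk : T (D k) = 0 := by
    have hxi : T (xi (F x)) = 0 := map_zero (transverseForm (F x).1)
    rw [show D k = _ from mfderiv_grad_height hF x, map_sub, map_smul, hTN, hxi, smul_zero,
      sub_zero]
  have hker : ∀ w, τ w = 0 → T (D w) = 0 := fun w hw =>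
    congr(transverse (F x).1 $(mfderiv_fst_apply (hF.mdifferentiableAt x) w)).symm.trans
      (transverse_mfderiv_eq_zero (mdifferentiableAt_fst.comp x (hF.mdifferentiableAt x)) hx hFx hw)
  by_contra hτk
  have hTD : ∀ w, T (D w) = 0 := fun w => by
    have hτ : τ (τ k • w - τ w • k) = 0 := by
      rw [map_sub, map_smul, map_smul, smul_eq_mul, smul_eq_mul, mul_comm, sub_self]
    have h := hker _ hτ
    rw [map_sub, map_smul, map_smul, map_sub, map_smul, map_smul, hTk, smul_zero, sub_zero] at h
    exact (smul_eq_zero.1 h).resolve_left hτk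
  obtain ⟨w, t, hwt⟩ := exists_mfderiv_add_smul_normal hF x
    ((EuclideanSpace.single (0 : Fin n) (1 : ℝ), 0) : EuclideanSpace ℝ (Fin n) × ℝ)
  have hT : T (D w + t • N x) = 1 :=
    (congrArg T hwt).trans ((PiLp.single_apply 2 ℝ (0 : Fin n) (1 : ℝ) 0).trans (if_pos rfl))
  rw [map_add, map_smul, hTD, hTN, smul_zero, add_zero] at hT
  exact zero_ne_one hT

theorem differential_height_innerUnitNormal (hF : IsTwoSidedHypersurface F N)
    (hfb : HasFreeBoundary F N) {x : S} (hx : x ∈ (𝓡∂ n).boundary S)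
    {ν : TangentSpace (𝓡∂ n) x} (hν : IsInnerUnitNormal x ν) :
    differential (𝓡∂ n) (height F) x ν = 0 := by
  rw [← inner_grad, real_inner_comm]
  exact hν.2.1 _ (transverse_grad_height_eq_zero hF hx ((hfb.1 x).1 hx) (hfb.2 x hx))

theorem norm_mfderiv_fst_of_height_eq_const (hF : IsTwoSidedHypersurface F N) {c : ℝ}
    (hc : ∀ x, height F x = c) (x : S) (v : TangentSpace (𝓡∂ n) x) :
    ‖mfderiv (𝓡∂ n) (𝓡∂ n) (fun p => (F p).1) x v‖ = ‖v‖ := by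
  have hvert : vert (F x) (mfderiv (𝓡∂ n) (cylModel n) F x v) = 0 := by
    rw [← differential_height (hF.mdifferentiableAt x), funext hc, differential_const]
  have hinner := hF.isometric x v v
  rw [cylMetric, hvert, mul_zero, add_zero, real_inner_self_eq_norm_sq,
    real_inner_self_eq_norm_sq] at hinner
  rw [mfderiv_fst_apply (hF.mdifferentiableAt x)]
  exact (sq_eq_sq₀ (norm_nonneg _) (norm_nonneg _)).1 hinner

variable [IsManifold (𝓡∂ n) ∞ S]
  [IsContMDiffRiemannianBundle (𝓡∂ n) 1 (EuclideanSpace ℝ (Fin n))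
    (fun x : M => TangentSpace (𝓡∂ n) x)]
  {h : M → ℝ} {v : ℝ → ℝ} {lam : ℝ}

/- `Δ_ψ η = v'(η) + θ H_ψ ≥ λ - λ = 0`, with equality once `η` is constant. -/
theorem exists_height_eq_const_and_curvature_slice_eq [Nonempty S]
    (hh : MDifferentiable (𝓡∂ n) 𝓘(ℝ, ℝ) h) (hv : Differentiable ℝ v)
    (hF : IsTwoSidedHypersurface F N) (hpar : IsParabolic (n := n) (productWeight h v ∘ F))
    (hbdd : BddAbove (range (height F))) (hlam : ∀ x, lam ≤ deriv v (height F x))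
    (hH : ∀ x, -lam ≤ angle F N x * weightedMeanCurvature (productWeight h v) F N x)
    (hν : ∀ x ∈ (𝓡∂ n).boundary S, ∀ ν : TangentSpace (𝓡∂ n) x, IsInnerUnitNormal x ν →
      0 ≤ differential (𝓡∂ n) (height F) x ν) :
    ∃ c, (∀ x, height F x = c) ∧ ∀ p : M,
      weightedMeanCurvature (productWeight h v) (slice c) (sliceNormal (n := n) c) p = lam := by
  have hsmooth : ContMDiff (𝓡∂ n) 𝓘(ℝ, ℝ) 2 (height F) := contMDiff_snd.comp hF.contMDiff_two
  have hlaplacian : ∀ x, driftedLaplacian (𝓡∂ n) (productWeight h v ∘ F) (height F) x =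
      deriv v (height F x) + angle F N x * weightedMeanCurvature (productWeight h v) F N x :=
    driftedLaplacian_height hF hh hv
  obtain ⟨c, hc⟩ := hpar (height F) hsmooth hbdd
    (fun x _ => by linarith [hlaplacian x, hlam x, hH x]) hν
  refine ⟨c, hc, fun p => ?_⟩
  obtain ⟨x⟩ := ‹Nonempty S›
  have hzero : 0 = deriv v c + angle F N x * weightedMeanCurvature (productWeight h v) F N x := by
    rw [← hc x, ← hlaplacian x, funext hc, driftedLaplacian_const]
  have hlam_c : lam ≤ deriv v c := hc x ▸ hlam x
  rw [weightedMeanCurvature_slice hh (hv c)]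
  linarith [hH x]

end Rigidity

end WeightedCylinder

open WeightedCylinder in
theorem theorem3p2_general {n : ℕ} [NeZero n]
    {M : Type*} [MetricSpace M] [ChartedSpace (EuclideanHalfSpace n) M] [IsManifold (𝓡∂ n) ∞ M]
    [RiemannianBundle (fun x : M => TangentSpace (𝓡∂ n) x)]
    [IsContMDiffRiemannianBundle (𝓡∂ n) 1 (EuclideanSpace ℝ (Fin n))
      (fun x : M => TangentSpace (𝓡∂ n) x)]
    [IsRiemannianManifold (𝓡∂ n) M]
    {h : M → ℝ} (hh : MDifferentiable (𝓡∂ n) 𝓘(ℝ, ℝ) h) {v : ℝ → ℝ} (hv : Differentiable ℝ v)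
    {lam a : ℝ} (hlam : 0 ≤ lam) (hva : ∀ t ≤ a, lam ≤ deriv v t)
    {S : Type*} [MetricSpace S] [ChartedSpace (EuclideanHalfSpace n) S] [IsManifold (𝓡∂ n) ∞ S]
    [RiemannianBundle (fun x : S => TangentSpace (𝓡∂ n) x)]
    [IsRiemannianManifold (𝓡∂ n) S] [Nonempty S]
    {F : S → M × ℝ} {N : ∀ x : S, TangentSpace (cylModel n) (F x)}
    (hF : IsTwoSidedHypersurface F N)
    (hpar : IsParabolic (n := n) (productWeight h v ∘ F))
    (hFa : ∀ x, (F x).2 ≤ a)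
    (hH : (∀ x, |weightedMeanCurvature (productWeight h v) F N x| ≤ lam) ∨
      ((∀ x, angle F N x ≤ 0) ∧ ∀ x, weightedMeanCurvature (productWeight h v) F N x ≤ lam)) :
    (((𝓡∂ n).boundary S).Nonempty → IsTangentToSlice (n := n) F a →
      range F ⊆ range (slice a) ∧
      ∀ p : M, weightedMeanCurvature (productWeight h v) (slice a) (sliceNormal (n := n) a) p
        = lam) ∧
    (CompleteSpace S → HasFreeBoundary F N →
      ∃ s : ℝ, range F = range (slice s) ∧
        ∀ p : M, weightedMeanCurvature (productWeight h v) (slice s) (sliceNormal (n := n) s) p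
          = lam) := by
  have hθH : ∀ x, -lam ≤ angle F N x * weightedMeanCurvature (productWeight h v) F N x := fun x =>
    neg_le_mul_of_abs_le_one (abs_angle_le_one hF x) hlam
      (hH.imp (fun hH => hH x) fun hH => ⟨hH.1 x, hH.2 x⟩)
  have hrigid := exists_height_eq_const_and_curvature_slice_eq hh hv hF hpar
    ⟨a, forall_mem_range.2 hFa⟩ (fun x => hva _ (hFa x)) hθH
  refine ⟨fun ⟨x₀, hx₀⟩ htan => ?_, fun _ hfb => ?_⟩
  · obtain ⟨c, hc, hcurv⟩ := hrigid fun x hx ν _ =>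
      ((differential_height (hF.mdifferentiableAt x) ν).trans
        (((htan x hx).2 _).1 ⟨ν, rfl⟩)).ge
    obtain rfl : c = a := (hc x₀).symm.trans (htan x₀ hx₀).1
    exact ⟨range_subset_range_slice hc, hcurv⟩
  · obtain ⟨c, hc, hcurv⟩ := hrigid fun x hx ν hν =>
      (differential_height_innerUnitNormal hF hfb hx hν).ge
    have hsurj : Function.Surjective fun x => (F x).1 :=
      surjective_of_norm_mfderiv_eq rfl ((contMDiff_fst.comp hF.contMDiff_two).of_le one_le_two)
        (norm_mfderiv_fst_of_height_eq_const hF hc) fun z => (hfb.1 z).symm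
    exact ⟨c, range_eq_range_slice hc hsurj, hcurv⟩

open WeightedCylinder in
theorem theorem3p2 {n : ℕ} [NeZero n]
    -- the base: a complete connected Riemannian manifold, possibly with boundary
    {M : Type*} [MetricSpace M] [ChartedSpace (EuclideanHalfSpace n) M] [IsManifold (𝓡∂ n) ∞ M]
    [RiemannianBundle (fun x : M => TangentSpace (𝓡∂ n) x)]
    [IsContMDiffRiemannianBundle (𝓡∂ n) ∞ (EuclideanSpace ℝ (Fin n))
      (fun x : M => TangentSpace (𝓡∂ n) x)]
    [IsRiemannianManifold (𝓡∂ n) M] [CompleteSpace M] [ConnectedSpace M]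
    -- the product weight
    (h : M → ℝ) (hh : ContMDiff (𝓡∂ n) 𝓘(ℝ, ℝ) ∞ h) (v : ℝ → ℝ) (hv : ContDiff ℝ ∞ v)
    (lam a : ℝ) (hlam : 0 ≤ lam) (hva : ∀ t ≤ a, lam ≤ deriv v t)
    -- the hypersurface, with its induced Riemannian metric and distance
    {S : Type*} [MetricSpace S] [ChartedSpace (EuclideanHalfSpace n) S] [IsManifold (𝓡∂ n) ∞ S]
    [RiemannianBundle (fun x : S => TangentSpace (𝓡∂ n) x)]
    [IsContMDiffRiemannianBundle (𝓡∂ n) ∞ (EuclideanSpace ℝ (Fin n))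
      (fun x : S => TangentSpace (𝓡∂ n) x)]
    [IsRiemannianManifold (𝓡∂ n) S] [ConnectedSpace S]
    (F : S → M × ℝ) (N : ∀ x : S, TangentSpace (cylModel n) (F x))
    (hF : IsTwoSidedHypersurface F N)
    (hpar : IsParabolic (n := n) (productWeight h v ∘ F))
    (hFa : ∀ x, (F x).2 ≤ a)
    (hH : (∀ x, |weightedMeanCurvature (productWeight h v) F N x| ≤ lam) ∨
      ((∀ x, angle F N x ≤ 0) ∧ ∀ x, weightedMeanCurvature (productWeight h v) F N x ≤ lam)) :
    (((𝓡∂ n).boundary S).Nonempty → IsTangentToSlice (n := n) F a →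
      range F ⊆ range (slice a) ∧
      ∀ p : M, weightedMeanCurvature (productWeight h v) (slice a) (sliceNormal (n := n) a) p
        = lam) ∧
    (CompleteSpace S → HasFreeBoundary F N →
      ∃ s : ℝ, range F = range (slice s) ∧
        ∀ p : M, weightedMeanCurvature (productWeight h v) (slice s) (sliceNormal (n := n) s) p
          = lam) := by
  have : IsContMDiffRiemannianBundle (𝓡∂ n) 1 (EuclideanSpace ℝ (Fin n))
      (fun x : M => TangentSpace (𝓡∂ n) x) := .of_le (n := ∞) (by simp)
  exact theorem3p2_general (hh.mdifferentiable (by simp)) (hv.differentiable (by simp)) hlam hva hF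
    hpar hFa hH
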